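/- All graphs are finite and simple. An edge coloring of a graph $G$ (adjacent edges may receive the same color) is a $3$-rainbow coloring if for every set $S$ of three vertices there is a tree $T\subseteq G$ containing $S$ no two edges of which have the same color; $rx_3(G)$ is the minimum number of colors in a $3$-rainbow coloring of $G$. A block of $G$ is a maximal connected subgraph of $G$ without a cut vertex (of its own). Let $\mathcal C$ be the set of blocks of $G$ of order at least $4$ that are cycles or have order at most $6$, and let $\mathcal D$ be the set of blocks of $G$ of order at least $7$ that are not cycles. **Theorem.** For every connected graph $G$ of order $n\ge 3$, $$rx_3(G)\le n-|\mathcal C|-2|\mathcal D|-1 .$$ This bound is tight: for all integers $r\ge 0$ and $n\ge 3r+7$ there is a connected graph $G$ of order $n$ whose blocks are exactly $n-3r-7$ copies of $K_2$, $r$ cycles of order $4$, and one cycle of order $7$ with one chord, so that $|\mathcal C|=r$ and $|\mathcal D|=1$, and for which $$rx_3(G)=n-|\mathcal C|-2|\mathcal D|-1=n-r-3 .$$ -/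

import Mathlib

namespace SimpleGraph

variable {V : Type*} {G : SimpleGraph V}

/-- A subgraph `T` of `G` is a *rainbow tree* for the (not necessarily proper) edge coloring `c`
if it is a tree no two of whose edges have the same color. -/
def IsRainbowTree {K : Type*} (c : G.EdgeLabeling K) (T : G.Subgraph) : Prop :=
  T.coe.IsTree ∧ Set.InjOn c {e : G.edgeSet | (e : Sym2 V) ∈ T.edgeSet}

/-- An edge coloring is a *`k`-rainbow coloring* if every set of `k` vertices is contained in a
rainbow tree. -/
def IsRainbowColoring {K : Type*} (k : ℕ) (c : G.EdgeLabeling K) : Prop :=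
  ∀ S : Finset V, S.card = k →
    ∃ T : G.Subgraph, IsRainbowTree c T ∧ (S : Set V) ⊆ T.verts

/-- The *`k`-rainbow index* `rx_k(G)`: the minimum number of colors in a `k`-rainbow coloring of
`G` (and `⊤` if there is no such coloring with finitely many colors). -/
noncomputable def rainbowIndex (k : ℕ) (G : SimpleGraph V) : ℕ∞ :=
  ⨅ m ∈ {m : ℕ | ∃ c : G.EdgeLabeling (Fin m), IsRainbowColoring k c}, (m : ℕ∞)

namespace Subgraph

/-- A subgraph is *nonseparable* if it is connected and has no cut vertex: deleting any of its
vertices leaves a connected graph (or, for a single vertex, nothing). -/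
def IsNonseparable (H : G.Subgraph) : Prop :=
  H.Connected ∧ ∀ v ∈ H.verts, (H.deleteVerts {v}).Preconnected

/-- A *block* of `G` is a maximal nonseparable subgraph of `G`. -/
def IsBlock (H : G.Subgraph) : Prop :=
  Maximal IsNonseparable H

/-- The subgraph is a cycle. -/
def IsCycleGraph (H : G.Subgraph) : Prop :=
  ∃ n : ℕ, 3 ≤ n ∧ Nonempty (H.coe ≃g cycleGraph n)

/-- The subgraph is a cycle of length `n` together with one chord, that is, an edge joining two
distinct vertices that are not adjacent on the cycle. -/
def IsCycleWithChord (n : ℕ) (H : G.Subgraph) : Prop :=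
  ∃ a b : Fin n, a ≠ b ∧ ¬ (cycleGraph n).Adj a b ∧
    Nonempty (H.coe ≃g (cycleGraph n ⊔ edge a b))

end Subgraph

/-- The blocks of order at least `4` that are cycles or have order at most `6`. -/
def blocksC (G : SimpleGraph V) : Set G.Subgraph :=
  {X | X.IsBlock ∧
    ((X.IsCycleGraph ∧ 4 ≤ X.verts.ncard) ∨ (4 ≤ X.verts.ncard ∧ X.verts.ncard ≤ 6))}

/-- The blocks of order at least `7` that are not cycles. -/
def blocksD (G : SimpleGraph V) : Set G.Subgraph :=
  {X | X.IsBlock ∧ ¬ X.IsCycleGraph ∧ 7 ≤ X.verts.ncard}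

end SimpleGraph

/-! Giving the edges of a spanning tree distinct colors takes `n - 1` colors, so the bound says how
many colors the blocks save: one for each block in `blocksC`, two for each block in `blocksD`.
Colorings with disjoint palettes glue at a cut vertex, and since the two orders add up to `n + 1`,
the savings add (`HasRainbow.sup`, `Subgraph.Connected.exists_hasRainbow`). This leaves a single
block.

A saving passes from a minor to the graph: a spanning forest of the contracted parts has at most as
many edges as the order drops, and giving them fresh colors lifts the coloring
(`HasRainbow.of_minor`). Hence it is enough to find small minors. A 4-cycle saves one color. A
7-cycle with a chord, a 6-cycle with a further vertex joined to two of its vertices, and `K_{2,4}`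
each save two; these are finite computations.

To find the minors, take a longest cycle of the block. If the order is at least four, so is its
length. If the block has order at least seven and is not a cycle, a spanning longest cycle has a
chord, and one of length at least six that misses a vertex has an ear. In the remaining case the
length is four or five; ears then have one interior vertex, and two missed vertices give either a
longer cycle or a `K_{2,4}` minor (`IsBiconnected.hasRainbow_three`).

For tightness, arrange the blocks in a chain that starts with the 7-cycle. A tree through two
suitable vertices of that cycle and the far end of the chain has at least `n - r - 2` vertices,
hence `n - r - 3` edges, all of different colors. -/

namespace SimpleGraph

/-! ### Rainbow connection of triples: gluing and lifting from minors -/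

section Rainbow

variable {V W : Type*}

/-- With at most `m` colors, `G` has an edge coloring in which any three vertices of `A` are joined
by a rainbow subgraph. -/
def HasRainbow (G : SimpleGraph V) (A : Set V) (m : ℕ) : Prop :=
  ∃ c : Sym2 V → ℕ, ∀ x ∈ A, ∀ y ∈ A, ∀ z ∈ A, ∃ H ≤ G, Set.InjOn c H.edgeSet ∧
    (∀ e ∈ H.edgeSet, c e < m) ∧ H.Reachable x y ∧ H.Reachable x z

theorem HasRainbow.mono {G G' : SimpleGraph V} {A A' : Set V} {m m' : ℕ}
    (h : HasRainbow G A m) (hG : G ≤ G') (hA : A' ⊆ A) (hm : m ≤ m') : HasRainbow G' A' m' := by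
  obtain ⟨c, hc⟩ := h
  refine ⟨c, fun x hx y hy z hz => ?_⟩
  obtain ⟨H, h1, h2, h3, h4⟩ := hc x (hA hx) y (hA hy) z (hA hz)
  exact ⟨H, h1.trans hG, h2, fun e he => (h3 e he).trans_le hm, h4⟩

/-- A rainbow subgraph joining three vertices contains a rainbow tree through them. -/
theorem exists_isRainbowTree {G H : SimpleGraph V} {K : Type*} (c : G.EdgeLabeling K) (hH : H ≤ G)
    (hc : Set.InjOn c {e : G.edgeSet | (e : Sym2 V) ∈ H.edgeSet}) (x : V) :
    ∃ T : G.Subgraph, IsRainbowTree c T ∧ ∀ y, H.Reachable x y → y ∈ T.verts := by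
  -- The tree is the component of `x` in a spanning forest of `H`.
  obtain ⟨F, hFH, hF, hr⟩ := H.exists_isAcyclic_reachable_eq_le
  let C := F.connectedComponentMk x
  let T : G.Subgraph :=
    { verts := C.supp
      Adj := fun a b => F.Adj a b ∧ a ∈ C.supp
      adj_sub := fun h => hH (hFH h.1)
      edge_vert := fun h => h.2
      symm := ⟨fun a b h => ⟨h.1.symm, (ConnectedComponent.mem_supp_congr_adj C h.1).1 h.2⟩⟩ }
  have hT : T.coe = C.toSimpleGraph := by
    ext a b
    exact ⟨fun h => h.1, fun h => ⟨h, a.2⟩⟩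
  refine ⟨T, ⟨?_, hc.mono fun e he => ?_⟩, fun y hy => ?_⟩
  · rw [hT]
    exact hF.isTree_connectedComponent C
  · obtain ⟨e, he'⟩ := e
    induction e with | _ a b =>
    exact hFH he.1
  · change y ∈ C.supp
    rw [ConnectedComponent.mem_supp_iff, ConnectedComponent.eq]
    rw [← hr] at hy
    exact hy.symm

theorem HasRainbow.rainbowIndex_le {G : SimpleGraph V} {m : ℕ} (h : HasRainbow G Set.univ m) :
    G.rainbowIndex 3 ≤ m := by
  classical
  obtain ⟨c, hc⟩ := h
  -- Without colors every `H` is edgeless, so there is at most one vertex and nothing to color or to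
  -- join. Otherwise colors are reduced modulo `m`, which leaves those on `H` unchanged.
  by_cases hm : m = 0
  · refine iInf₂_le_of_le 0 ⟨fun e => ?_, fun S hS => ?_⟩ (by simp)
    · exfalso
      obtain ⟨e, he⟩ := e
      induction e with | _ a b =>
      obtain ⟨H, h1, h2, h3, h4, -⟩ := hc a trivial b trivial a trivial
      obtain rfl : H = ⊥ := by
        rw [← edgeSet_eq_empty, Set.eq_empty_iff_forall_notMem]
        intro e he
        have := h3 e he
        omega
      rw [reachable_bot] at h4
      exact (mem_edgeSet G |>.1 he).ne h4
    · exfalso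
      obtain ⟨x, y, z, hxy, -, -, rfl⟩ := Finset.card_eq_three.1 hS
      obtain ⟨H, h1, h2, h3, h4, -⟩ := hc x trivial y trivial z trivial
      obtain rfl : H = ⊥ := by
        rw [← edgeSet_eq_empty, Set.eq_empty_iff_forall_notMem]
        intro e he
        have := h3 e he
        omega
      rw [reachable_bot] at h4
      exact hxy h4
  · have : NeZero m := ⟨hm⟩
    refine iInf₂_le_of_le m ⟨fun e => Fin.ofNat m (c e), fun S hS => ?_⟩ le_rfl
    obtain ⟨x, y, z, -, -, -, rfl⟩ := Finset.card_eq_three.1 hS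
    obtain ⟨H, h1, h2, h3, h4, h5⟩ := hc x trivial y trivial z trivial
    obtain ⟨T, hT, hT'⟩ := exists_isRainbowTree (G := G) (H := H)
      (fun e => Fin.ofNat m (c e)) h1 (by
        rintro e he e' he' hee
        apply Subtype.ext
        apply h2 he he'
        simpa [Fin.ext_iff, Nat.mod_eq_of_lt (h3 _ he), Nat.mod_eq_of_lt (h3 _ he')] using hee) x
    refine ⟨T, hT, ?_⟩
    intro w hw
    simp only [Finset.coe_insert, Finset.coe_singleton, Set.mem_insert_iff,
      Set.mem_singleton_iff] at hw
    rcases hw with rfl | rfl | rfl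
    · exact hT' _ (Reachable.refl _)
    · exact hT' _ h4
    · exact hT' _ h5

/-- Rainbow colorings of two edge-disjoint graphs with a common vertex combine. -/
theorem HasRainbow.sup {G₁ G₂ : SimpleGraph V} {A₁ A₂ : Set V} {m₁ m₂ : ℕ} {v : V}
    (h₁ : HasRainbow G₁ A₁ m₁) (h₂ : HasRainbow G₂ A₂ m₂) (hd : Disjoint G₁.edgeSet G₂.edgeSet)
    (hv₁ : v ∈ A₁) (hv₂ : v ∈ A₂) : HasRainbow (G₁ ⊔ G₂) (A₁ ∪ A₂) (m₁ + m₂) := by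
  classical
  obtain ⟨c₁, hc₁⟩ := h₁
  obtain ⟨c₂, hc₂⟩ := h₂
  -- Each vertex is replaced on the other side by the common vertex `v`, so the two rainbow
  -- subgraphs meet at `v` whenever both are needed. The colors of the second are shifted by `m₁`.
  let p₁ : V → V := fun x => if x ∈ A₁ then x else v
  let p₂ : V → V := fun x => if x ∈ A₁ then v else x
  have hp₁ : ∀ x, p₁ x ∈ A₁ := fun x => by
    by_cases h : x ∈ A₁ <;> simp [p₁, h, hv₁]
  have hp₂ : ∀ x ∈ A₁ ∪ A₂, p₂ x ∈ A₂ := fun x hx => by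
    by_cases h : x ∈ A₁
    · simp [p₂, h, hv₂]
    · simpa [p₂, h] using hx.resolve_left h
  refine ⟨fun e => if e ∈ G₁.edgeSet then c₁ e else m₁ + c₂ e, fun x hx y hy z hz => ?_⟩
  obtain ⟨H₁, a1, a2, a3, a4, a5⟩ := hc₁ _ (hp₁ x) _ (hp₁ y) _ (hp₁ z)
  obtain ⟨H₂, b1, b2, b3, b4, b5⟩ := hc₂ _ (hp₂ x hx) _ (hp₂ y hy) _ (hp₂ z hz)
  have e1 : ∀ e ∈ H₁.edgeSet, e ∈ G₁.edgeSet := fun e he => edgeSet_mono a1 he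
  have e2 : ∀ e ∈ H₂.edgeSet, e ∉ G₁.edgeSet := fun e he h =>
    Set.disjoint_left.1 hd h (edgeSet_mono b1 he)
  have key : ∀ y, H₁.Reachable (p₁ x) (p₁ y) → H₂.Reachable (p₂ x) (p₂ y) →
      (H₁ ⊔ H₂).Reachable x y := by
    intro y h1 h2
    have h1 := h1.mono (le_sup_left : H₁ ≤ H₁ ⊔ H₂)
    have h2 := h2.mono (le_sup_right : H₂ ≤ H₁ ⊔ H₂)
    by_cases hx : x ∈ A₁ <;> by_cases hy : y ∈ A₁ <;> simp only [p₁, p₂, hx, hy, if_true, if_false]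
      at h1 h2
    · exact h1
    · exact h1.trans h2
    · exact h2.trans h1
    · exact h2
  refine ⟨H₁ ⊔ H₂, sup_le_sup a1 b1, ?_, ?_, key y a4 b4, key z a5 b5⟩
  · intro e he e' he' h
    rw [edgeSet_sup] at he he'
    rcases he with he | he <;> rcases he' with he' | he'
    · simp only [e1 e he, e1 e' he', if_true] at h
      exact a2 he he' h
    · simp only [e1 e he, e2 e' he', if_true, if_false] at h
      have := a3 e he
      omega
    · simp only [e2 e he, e1 e' he', if_true, if_false] at h
      have := a3 e' he'
      omega
    · simp only [e2 e he, e2 e' he', if_false] at h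
      exact b2 he he' (by omega)
  · intro e he
    rw [edgeSet_sup] at he
    rcases he with he | he
    · simp only [e1 e he, if_true]
      have := a3 e he
      omega
    · simp only [e2 e he, if_false]
      have := b3 e he
      omega

/-- The edges of `G` inside the fibers of `f` over `U`. -/
def fiberGraph (G : SimpleGraph V) (U : Set V) (f : V → W) : SimpleGraph V where
  Adj a b := G.Adj a b ∧ a ∈ U ∧ b ∈ U ∧ f a = f b
  symm := ⟨fun _ _ h => ⟨h.1.symm, h.2.2.1, h.2.1, h.2.2.2.symm⟩⟩
  loopless := ⟨fun _ h => h.1.ne rfl⟩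

theorem fiberGraph_le (G : SimpleGraph V) (U : Set V) (f : V → W) : fiberGraph G U f ≤ G :=
  fun _ _ h => h.1

/-- A spanning forest of the fibers of a surjection with connected fibers has few edges. -/
theorem ncard_edgeSet_add_card_le [Fintype V] [Fintype W] {G F : SimpleGraph V} {f : V → W}
    (hG : G.Connected) (hf : f.Surjective) (hF : F ≤ fiberGraph G Set.univ f) (hac : F.IsAcyclic) :
    F.edgeSet.ncard + Fintype.card W ≤ Fintype.card V := by
  classical
  obtain ⟨T, hFT, hTG, hT⟩ :=
    hG.exists_isTree_le_of_le_of_isAcyclic (hF.trans (fiberGraph_le _ _ _)) hac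
  -- `F` extends to a spanning tree `T` of `G`. The edges of `T` outside `F` connect the quotient,
  -- so there are at least `|W| - 1` of them, out of `|V| - 1`.
  let Q : SimpleGraph W := fromEdgeSet (Sym2.map f '' (T.edgeSet \ F.edgeSet))
  have hQ : Q.Connected := by
    have hr : ∀ x y, T.Reachable x y → Q.Reachable (f x) (f y) := by
      rintro x y ⟨p⟩
      induction p with
      | nil => rfl
      | @cons a b _ h _ ih =>
        by_cases hab : f a = f b
        · rwa [hab]
        · refine (Adj.reachable ?_).trans ih
          rw [fromEdgeSet_adj]
          exact ⟨⟨s(a, b), ⟨h, fun h' => hab (hF h').2.2.2⟩, rfl⟩, hab⟩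
    have : Nonempty W := hG.nonempty.map f
    refine ⟨fun w w' => ?_⟩
    obtain ⟨x, rfl⟩ := hf w
    obtain ⟨y, rfl⟩ := hf w'
    exact hr x y (hT.connected x y)
  have h1 := hQ.card_vert_le_card_edgeSet_add_one
  have h2 : Nat.card Q.edgeSet ≤ (T.edgeSet \ F.edgeSet).ncard := by
    rw [Nat.card_coe_set_eq]
    refine (Set.ncard_le_ncard (t := Sym2.map f '' (T.edgeSet \ F.edgeSet)) ?_
      (Set.toFinite _)).trans (Set.ncard_image_le (Set.toFinite _))
    rw [edgeSet_fromEdgeSet]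
    exact Set.sdiff_subset
  have h3 := Set.ncard_sdiff_add_ncard_of_subset (edgeSet_mono hFT) (Set.toFinite _)
  have h4 := hT.card_edgeFinset
  rw [← Set.ncard_coe_finset, coe_edgeFinset] at h4
  rw [Nat.card_eq_fintype_card] at h1
  omega

/-- A rainbow coloring of a minor of a connected graph lifts to the graph, with one new color for
each contracted edge. -/
theorem HasRainbow.of_minor [Fintype V] [Fintype W] {G : SimpleGraph V} {Q : SimpleGraph W}
    {f : V → W} {m m' : ℕ} (hQ : HasRainbow Q Set.univ m) (hG : G.Connected) (hf : f.Surjective)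
    (hfib : ∀ x y, f x = f y → (fiberGraph G Set.univ f).Reachable x y)
    (hlift : ∀ w w', Q.Adj w w' → ∃ a b, f a = w ∧ f b = w' ∧ G.Adj a b)
    (hm : m + Fintype.card V ≤ m' + Fintype.card W) : HasRainbow G Set.univ m' := by
  classical
  obtain ⟨F, hFle, hF, hr⟩ := (fiberGraph G Set.univ f).exists_isAcyclic_reachable_eq_le
  have hcard := ncard_edgeSet_add_card_le hG hf hFle hF
  obtain ⟨c, hc⟩ := hQ
  have hl : ∀ e : Sym2 W, ∃ e' : Sym2 V, e ∈ Q.edgeSet → e' ∈ G.edgeSet ∧ e'.map f = e := by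
    intro e
    by_cases he : e ∈ Q.edgeSet
    · induction e with | _ w w' =>
      obtain ⟨a, b, rfl, rfl, h⟩ := hlift w w' he
      exact ⟨s(a, b), fun _ => ⟨h, rfl⟩⟩
    · obtain ⟨x⟩ := hG.nonempty
      exact ⟨s(x, x), fun h => (he h).elim⟩
  choose l hl using hl
  let idx := Finite.equivFinOfCardEq (Nat.card_coe_set_eq F.edgeSet)
  -- Forest edges get private colors from `m` on, the others the color of their image. A rainbow `H`
  -- in the minor then lifts to `F` together with one chosen lift of each edge of `H`.
  let c' : Sym2 V → ℕ := fun e => if h : e ∈ F.edgeSet then m + idx ⟨e, h⟩ else c (e.map f)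
  refine ⟨c', fun x _ y _ z _ => ?_⟩
  obtain ⟨H, a1, a2, a3, a4, a5⟩ := hc (f x) trivial (f y) trivial (f z) trivial
  have hH : ∀ e ∈ H.edgeSet, l e ∈ G.edgeSet ∧ (l e).map f = e :=
    fun e he => hl e (edgeSet_mono a1 he)
  have hFn : ∀ e ∈ F.edgeSet, (e.map f).IsDiag := by
    intro e he
    induction e with | _ a b =>
    exact (hFle he).2.2.2
  have hlF : ∀ e ∈ H.edgeSet, l e ∉ F.edgeSet := by
    intro e he h
    have := hFn _ h
    rw [(hH e he).2] at this
    exact H.not_isDiag_of_mem_edgeSet he this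
  have hcF : ∀ e (h : e ∈ F.edgeSet), c' e = m + idx ⟨e, h⟩ := fun e h => dif_pos h
  have hcl : ∀ e ∈ H.edgeSet, c' (l e) = c e := fun e he => by
    simp only [c', hlF e he, dif_neg, not_false_eq_true, (hH e he).2]
  have hE : (F ⊔ fromEdgeSet (l '' H.edgeSet)).edgeSet = F.edgeSet ∪ l '' H.edgeSet := by
    rw [edgeSet_sup, edgeSet_fromEdgeSet, sdiff_eq_left.2]
    rw [Set.disjoint_left]
    rintro _ ⟨e, he, rfl⟩ h
    exact G.not_isDiag_of_mem_edgeSet (hH e he).1 h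
  have hfr : ∀ x y, f x = f y → (F ⊔ fromEdgeSet (l '' H.edgeSet)).Reachable x y := by
    intro x y h
    have := hfib x y h
    rw [← hr] at this
    exact this.mono le_sup_left
  have key : ∀ w w', H.Reachable w w' → ∀ x y, f x = w → f y = w' →
      (F ⊔ fromEdgeSet (l '' H.edgeSet)).Reachable x y := by
    rintro w w' ⟨p⟩
    induction p with
    | nil => rintro x y rfl h; exact hfr x y h.symm
    | @cons u v _ h _ ih =>
      intro x y hx hy
      obtain ⟨a, b, hab, ha, hb⟩ : ∃ a b, l s(u, v) = s(a, b) ∧ f a = u ∧ f b = v := by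
        have := (hH s(u, v) h).2
        generalize l s(u, v) = e at this
        induction e with | _ a b =>
        rw [Sym2.map_mk, Sym2.eq_iff] at this
        rcases this with h | h
        · exact ⟨a, b, rfl, h⟩
        · exact ⟨b, a, Sym2.eq_swap, h.2, h.1⟩
      have h1 : (F ⊔ fromEdgeSet (l '' H.edgeSet)).Adj a b := by
        rw [← mem_edgeSet, hE, ← hab]
        exact Or.inr ⟨_, h, rfl⟩
      exact (hfr x a (hx.trans ha.symm)).trans (h1.reachable.trans (ih b y hb hy))
  refine ⟨F ⊔ fromEdgeSet (l '' H.edgeSet), ?_, ?_, ?_, key _ _ a4 _ _ rfl rfl,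
    key _ _ a5 _ _ rfl rfl⟩
  · rw [← edgeSet_subset_edgeSet, hE]
    rintro e (he | ⟨e, he, rfl⟩)
    · exact edgeSet_mono (hFle.trans (fiberGraph_le _ _ _)) he
    · exact (hH e he).1
  · rw [hE]
    rintro _ (he | ⟨e, he, rfl⟩) _ (he' | ⟨e', he', rfl⟩) h
    · rw [hcF _ he, hcF _ he'] at h
      have := idx.injective (Fin.ext (Nat.add_left_cancel h))
      exact congrArg Subtype.val this
    · rw [hcF _ he, hcl _ he'] at h
      have := a3 _ he'
      omega
    · rw [hcF _ he', hcl _ he] at h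
      have := a3 _ he
      omega
    · rw [hcl _ he, hcl _ he'] at h
      rw [a2 he he' h]
  · rw [hE]
    rintro _ (he | ⟨e, he, rfl⟩)
    · rw [hcF _ he]
      have := (idx ⟨_, he⟩).2
      omega
    · rw [hcl _ he]
      have := a3 _ he
      have := Fintype.card_le_of_surjective f hf
      omega

/-- A partial map with connected fibers extends to the whole of a connected graph. -/
theorem exists_extend_fibers [Finite V] {G : SimpleGraph V} (hG : G.Connected) {U : Set V}
    (hU : U.Nonempty) (f : V → W)
    (hf : ∀ x ∈ U, ∀ y ∈ U, f x = f y → (fiberGraph G U f).Reachable x y) :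
    ∃ f' : V → W, Set.EqOn f' f U ∧
      ∀ x y, f' x = f' y → (fiberGraph G Set.univ f').Reachable x y := by
  classical
  induction hk : (Uᶜ).ncard generalizing U f with
  | zero =>
    rw [Set.ncard_eq_zero, Set.compl_empty_iff] at hk
    subst hk
    exact ⟨f, fun _ _ => rfl, fun x y h => hf x trivial y trivial h⟩
  | succ k ih =>
    obtain ⟨b₀, hb₀⟩ : (Uᶜ).Nonempty := by
      rw [← Set.ncard_pos]
      omega
    obtain ⟨a₀, ha₀⟩ := hU
    obtain ⟨p⟩ := hG a₀ b₀
    -- A vertex `b` outside `U` with a neighbor `a` in `U` joins the fiber of `a`.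
    obtain ⟨d, -, ha, hb⟩ := p.exists_boundary_dart U ha₀ hb₀
    obtain ⟨⟨a, b⟩, hab⟩ := d
    simp only at ha hb hab
    have hne : ∀ x ∈ U, x ≠ b := fun x hx h => hb (h ▸ hx)
    have hup : ∀ x ∈ U, Function.update f b (f a) x = f x := fun x hx =>
      Function.update_of_ne (hne x hx) _ _
    have hle : fiberGraph G U f ≤ fiberGraph G (insert b U) (Function.update f b (f a)) := by
      intro x y h
      exact ⟨h.1, Or.inr h.2.1, Or.inr h.2.2.1, by rw [hup _ h.2.1, hup _ h.2.2.1, h.2.2.2]⟩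
    have hba : (fiberGraph G (insert b U) (Function.update f b (f a))).Adj a b :=
      ⟨hab, Or.inr ha, Or.inl rfl, by rw [hup a ha, Function.update_self]⟩
    obtain ⟨f', h1, h2⟩ := ih (U := insert b U) (Set.insert_nonempty _ _)
      (Function.update f b (f a)) (by
        rintro x (rfl | hx) y (rfl | hy) h
        · rfl
        · rw [Function.update_self, hup _ hy] at h
          exact hba.symm.reachable.trans ((hf a ha y hy h).mono hle)
        · rw [Function.update_self, hup _ hx] at h
          exact ((hf x hx a ha h).mono hle).trans hba.reachable
        · rw [hup _ hy, hup _ hx] at h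
          exact (hf x hx y hy h).mono hle) (by
        have : (insert b U)ᶜ = Uᶜ \ {b} := by
          ext; simp [not_or, and_comm]
        rw [this, Set.ncard_sdiff_singleton_of_mem hb, hk]
        rfl)
    exact ⟨f', fun x hx => (h1 (Or.inr hx)).trans (hup x hx), h2⟩

/-- A list of distinct vertices, cut into intervals that are paths of `G`, whose intervals are
joined by edges as in `Q`. -/
theorem HasRainbow.of_list [Fintype V] [Fintype W] {G : SimpleGraph V} {Q : SimpleGraph W}
    {m m' : ℕ} (hQ : HasRainbow Q Set.univ m) (hG : G.Connected) {l : List V} (hl : l.Nodup)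
    (hne : l ≠ []) (g : ℕ → W) (hsurj : ∀ w, ∃ i < l.length, g i = w)
    (hg : ∀ i j (hij : i < j) (hj : j < l.length), g i = g j → g (j - 1) = g j ∧
      G.Adj (l[j - 1]'(by omega)) l[j])
    (hlift : ∀ w w', Q.Adj w w' → ∃ (i j : ℕ) (hi : i < l.length) (hj : j < l.length),
      g i = w ∧ g j = w' ∧ G.Adj l[i] l[j])
    (hm : m + Fintype.card V ≤ m' + Fintype.card W) : HasRainbow G Set.univ m' := by
  classical
  let f : V → W := fun v => g (l.idxOf v)
  have hf : ∀ i (hi : i < l.length), f l[i] = g i := fun i hi => by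
    simp only [f]
    rw [hl.idxOf_getElem]
  have hfib : ∀ k i (h : i + k < l.length), g i = g (i + k) →
      (fiberGraph G {v | v ∈ l} f).Reachable l[i] l[i + k] := by
    intro k
    induction k with
    | zero => intro i h _; rfl
    | succ k ih =>
      intro i h he
      obtain ⟨h1, h2⟩ := hg i (i + (k + 1)) (by omega) h he
      simp only [← Nat.add_assoc, Nat.add_sub_cancel] at h1 h2 ⊢
      refine (ih i (by omega) (by rw [h1, he, Nat.add_assoc])).trans (Adj.reachable ?_)
      exact ⟨h2, List.getElem_mem _, List.getElem_mem _, by rw [hf, hf, h1]⟩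
  obtain ⟨f', h1, h2⟩ := exists_extend_fibers hG (U := {v | v ∈ l})
    (List.exists_mem_of_ne_nil l hne) f (by
      intro x hx y hy hxy
      obtain ⟨i, hi, rfl⟩ := List.getElem_of_mem hx
      obtain ⟨j, hj, rfl⟩ := List.getElem_of_mem hy
      rw [hf, hf] at hxy
      rcases le_total i j with h | h
      · obtain ⟨k, rfl⟩ := Nat.exists_eq_add_of_le h
        exact hfib k i hj hxy
      · obtain ⟨k, rfl⟩ := Nat.exists_eq_add_of_le h
        exact (hfib k j hi hxy.symm).symm)
  have hf' : ∀ i (hi : i < l.length), f' l[i] = g i := fun i hi =>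
    (h1 (List.getElem_mem hi)).trans (hf i hi)
  refine hQ.of_minor hG (f := f') (fun w => ?_) h2 (fun w w' h => ?_) hm
  · obtain ⟨i, hi, rfl⟩ := hsurj w
    exact ⟨_, hf' i hi⟩
  · obtain ⟨i, j, hi, hj, rfl, rfl, hij⟩ := hlift w w' h
    exact ⟨_, _, hf' i hi, hf' j hj, hij⟩

/-- The whole graph is contracted to a point, which needs no color. -/
theorem Connected.hasRainbow [Fintype V] {G : SimpleGraph V} (hG : G.Connected) {m : ℕ}
    (hm : Fintype.card V ≤ m + 1) : HasRainbow G Set.univ m := by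
  have hQ : HasRainbow (⊥ : SimpleGraph Unit) Set.univ 0 :=
    ⟨fun _ => 0, fun x _ y _ z _ => ⟨⊥, le_rfl, by simp, by simp, by rfl, by rfl⟩⟩
  obtain ⟨v⟩ := hG.nonempty
  exact hQ.of_list hG (l := [v]) (by simp) (by simp) (fun _ => ())
    (fun _ => ⟨0, by simp, rfl⟩) (fun i j hij hj => by simp at hj; omega)
    (fun w w' h => h.elim) (by simpa using hm)

end Rainbow

/-! ### The small minors, checked by computation -/

section Check

/-- The graph on `Fin k` with the listed edges. -/
def listGraph (k : ℕ) (E : List (ℕ × ℕ)) : SimpleGraph (Fin k) where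
  Adj a b := a ≠ b ∧ (((a : ℕ), (b : ℕ)) ∈ E ∨ ((b : ℕ), (a : ℕ)) ∈ E)
  symm := ⟨fun _ _ h => ⟨h.1.symm, h.2.symm⟩⟩
  loopless := ⟨fun _ h => h.1 rfl⟩

/-- The position of the first class that contains the edge. -/
def classIdx (cls : List (List (ℕ × ℕ))) (e : Sym2 ℕ) : ℕ :=
  cls.findIdx fun cl => cl.any fun p => decide (s(p.1, p.2) = e)

/-- One round of search along the edges `es`. -/
def growStep (es : List (ℕ × ℕ)) (vis : List ℕ) : List ℕ :=
  es.foldl (fun vis p => if p.1 ∈ vis then p.2 :: vis else if p.2 ∈ vis then p.1 :: vis else vis) vis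

/-- The vertices found from `x` along the edges `es`. -/
def grow (es : List (ℕ × ℕ)) (x : ℕ) : List ℕ := (growStep es)^[es.length] [x]

/-- `cls` lists the color classes of an edge coloring for which any three of the vertices
`0, …, k - 1` are joined by a choice of one edge from each class. -/
def RainbowClasses (k : ℕ) (cls : List (List (ℕ × ℕ))) : Prop :=
  (∀ p ∈ cls.flatten, p.1 < k ∧ p.2 < k ∧ p.1 ≠ p.2) ∧
  (∀ es ∈ cls.sections, (es.map fun p => classIdx cls s(p.1, p.2)).Nodup ∧
    ∀ p ∈ es, classIdx cls s(p.1, p.2) < cls.length ∧ p ∈ cls.flatten) ∧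
  ∀ x ∈ List.range k, ∀ y ∈ List.range k, ∀ z ∈ List.range k, ∃ es ∈ cls.sections,
    y ∈ grow es x ∧ z ∈ grow es x

instance (k : ℕ) (cls : List (List (ℕ × ℕ))) : Decidable (RainbowClasses k cls) := by
  unfold RainbowClasses
  infer_instance

/-- Only the soundness of the search matters: each round preserves the invariant that all vertices
found are reachable, however many rounds there are. -/
theorem reachable_of_mem_grow {k : ℕ} {H : SimpleGraph (Fin k)} {es : List (ℕ × ℕ)} {x : Fin k}
    (hes : ∀ p ∈ es, ∃ a b : Fin k, p = (↑a, ↑b) ∧ H.Adj a b) {y : ℕ} (hy : y ∈ grow es x) :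
    ∃ w : Fin k, (w : ℕ) = y ∧ H.Reachable x w := by
  have step : ∀ es' : List (ℕ × ℕ), (∀ p ∈ es', p ∈ es) → ∀ vis : List ℕ,
      (∀ v ∈ vis, ∃ w : Fin k, (w : ℕ) = v ∧ H.Reachable x w) →
      ∀ v ∈ growStep es' vis, ∃ w : Fin k, (w : ℕ) = v ∧ H.Reachable x w := by
    intro es'
    induction es' with
    | nil => exact fun _ vis h => h
    | cons p es' ih =>
      intro hp vis h
      refine ih (fun q hq => hp q (List.mem_cons_of_mem _ hq)) _ ?_
      obtain ⟨a, b, rfl, hab⟩ := hes p (hp p List.mem_cons_self)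
      intro v hv
      simp only at hv
      split_ifs at hv with h1 h2
      · obtain ⟨w, hw, hr⟩ := h _ h1
        obtain rfl : w = a := Fin.ext hw
        rcases List.mem_cons.1 hv with rfl | hv
        · exact ⟨b, rfl, hr.trans hab.reachable⟩
        · exact h v hv
      · obtain ⟨w, hw, hr⟩ := h _ h2
        obtain rfl : w = b := Fin.ext hw
        rcases List.mem_cons.1 hv with rfl | hv
        · exact ⟨a, rfl, hr.trans hab.symm.reachable⟩
        · exact h v hv
      · exact h v hv
  have it : ∀ n : ℕ, ∀ v ∈ (growStep es)^[n] [(x : ℕ)],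
      ∃ w : Fin k, (w : ℕ) = v ∧ H.Reachable x w := by
    intro n
    induction n with
    | zero =>
      intro v hv
      obtain rfl := List.mem_singleton.1 hv
      exact ⟨x, rfl, Reachable.refl x⟩
    | succ n ih =>
      rw [Function.iterate_succ_apply']
      exact step es (fun _ h => h) _ ih
  exact it _ y hy

/-- An edge is colored by the first class containing it. The edges of a section have distinct class
indices, so they form a rainbow subgraph. -/
theorem RainbowClasses.hasRainbow {k : ℕ} {cls : List (List (ℕ × ℕ))} (h : RainbowClasses k cls) :
    HasRainbow (listGraph k cls.flatten) Set.univ cls.length := by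
  obtain ⟨h1, h2, h3⟩ := h
  refine ⟨fun e => classIdx cls (e.map Fin.val), fun x _ y _ z _ => ?_⟩
  obtain ⟨es, hes, hy, hz⟩ := h3 x (List.mem_range.2 x.2) y (List.mem_range.2 y.2) z (List.mem_range.2 z.2)
  obtain ⟨hn, hm⟩ := h2 es hes
  let H : SimpleGraph (Fin k) := fromEdgeSet {e | ∃ p ∈ es, e.map Fin.val = s(p.1, p.2)}
  have hH : ∀ e ∈ H.edgeSet, ∃ p ∈ es, e.map Fin.val = s(p.1, p.2) := fun e he => by
    rw [edgeSet_fromEdgeSet] at he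
    exact he.1
  have hr : ∀ p ∈ es, ∃ a b : Fin k, p = (↑a, ↑b) ∧ H.Adj a b := by
    intro p hp
    obtain ⟨p1, p2, p3⟩ := h1 p (hm p hp).2
    refine ⟨⟨p.1, p1⟩, ⟨p.2, p2⟩, rfl, ?_⟩
    rw [fromEdgeSet_adj]
    exact ⟨⟨p, hp, rfl⟩, fun h => p3 (Fin.ext_iff.1 h)⟩
  refine ⟨H, ?_, ?_, ?_, ?_, ?_⟩
  · intro a b hab
    obtain ⟨p, hp, he⟩ := hH s(a, b) hab
    refine ⟨hab.ne, ?_⟩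
    rw [Sym2.map_mk, Sym2.eq_iff] at he
    rcases he with ⟨e1, e2⟩ | ⟨e1, e2⟩
    · left
      rw [e1, e2]
      exact (hm p hp).2
    · right
      rw [e1, e2]
      exact (hm p hp).2
  · intro e he e' he' hee
    obtain ⟨p, hp, hpe⟩ := hH e he
    obtain ⟨p', hp', hpe'⟩ := hH e' he'
    simp only [hpe, hpe'] at hee
    have := List.inj_on_of_nodup_map hn hp hp' hee
    subst this
    exact Sym2.map.injective Fin.val_injective (hpe.trans hpe'.symm)
  · intro e he
    obtain ⟨p, hp, hpe⟩ := hH e he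
    simp only [hpe]
    exact (hm p hp).1
  · obtain ⟨w, hw, h⟩ := reachable_of_mem_grow hr hy
    rwa [Fin.ext hw] at h
  · obtain ⟨w, hw, h⟩ := reachable_of_mem_grow hr hz
    rwa [Fin.ext hw] at h

theorem RainbowClasses.of_list {V : Type*} [Fintype V] {G : SimpleGraph V} {k m : ℕ}
    {cls : List (List (ℕ × ℕ))} (h : RainbowClasses k cls) (hG : G.Connected) {l : List V}
    (hl : l.Nodup) (hne : l ≠ []) (g : ℕ → ℕ) (hk : ∀ i < l.length, g i < k)
    (hsurj : ∀ w < k, ∃ i < l.length, g i = w)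
    (hg : ∀ i j (hij : i < j) (hj : j < l.length), g i = g j → g (j - 1) = g j ∧
      G.Adj (l[j - 1]'(by omega)) l[j])
    (hlift : ∀ p ∈ cls.flatten, ∃ (i j : ℕ) (hi : i < l.length) (hj : j < l.length),
      g i = p.1 ∧ g j = p.2 ∧ G.Adj l[i] l[j])
    (hm : cls.length + Fintype.card V ≤ m + k) : HasRainbow G Set.univ m := by
  have hk0 : 0 < k := (Nat.zero_le _).trans_lt (hk 0 (List.length_pos_of_ne_nil hne))
  have : NeZero k := ⟨hk0.ne'⟩
  have hgf : ∀ i < l.length, ((Fin.ofNat k (g i) : Fin k) : ℕ) = g i := fun i hi => by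
    simp [Nat.mod_eq_of_lt (hk i hi)]
  refine h.hasRainbow.of_list hG hl hne (fun i => Fin.ofNat k (g i)) ?_ ?_ ?_ (by simpa using hm)
  · intro w
    obtain ⟨i, hi, hw⟩ := hsurj w w.2
    exact ⟨i, hi, Fin.ext ((hgf i hi).trans hw)⟩
  · intro i j hij hj hgij
    have hgij := congrArg Fin.val hgij
    rw [hgf i (by omega), hgf j hj] at hgij
    obtain ⟨h1, h2⟩ := hg i j hij hj hgij
    exact ⟨by rw [h1], h2⟩
  · rintro w w' ⟨-, hw | hw⟩
    · obtain ⟨i, j, hi, hj, h1, h2, h3⟩ := hlift _ hw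
      exact ⟨i, j, hi, hj, Fin.ext ((hgf i hi).trans h1), Fin.ext ((hgf j hj).trans h2), h3⟩
    · obtain ⟨i, j, hi, hj, h1, h2, h3⟩ := hlift _ hw
      exact ⟨j, i, hj, hi, Fin.ext ((hgf j hj).trans h2), Fin.ext ((hgf i hi).trans h1), h3.symm⟩

/-- Opposite edges share a color; one edge of each color is a path on three vertices, and the four
choices give all four triples. -/
theorem rainbowClasses_cycle_four : RainbowClasses 4 [[(0, 1), (2, 3)], [(1, 2), (3, 0)]] := by
  decide +kernel

/-- This is `K_{2,4}` with sides `{0, 1}` and `{2, 3, 4, 5}`: three colors, two fewer than a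
spanning tree has edges. -/
theorem rainbowClasses_completeBipartite : RainbowClasses 6
    [[(0, 2), (0, 3), (1, 4), (1, 5)], [(0, 4), (1, 2)], [(0, 5), (1, 3)]] := by
  decide +kernel

/-- Color classes of a cycle of length six with a further vertex joined to `0` and `t`. -/
def apexClasses : ℕ → List (List (ℕ × ℕ))
  | 1 => [[(0, 1), (3, 4)], [(1, 2), (4, 5)], [(2, 3), (0, 6)], [(5, 0), (1, 6)]]
  | 2 => [[(0, 1), (2, 3)], [(1, 2), (3, 4), (0, 6)], [(4, 5), (2, 6)], [(5, 0)]]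
  | 3 => [[(0, 1), (2, 3)], [(1, 2), (3, 4), (0, 6)], [(4, 5), (3, 6)], [(5, 0)]]
  | 4 => [[(0, 1), (2, 3)], [(1, 2), (3, 4)], [(4, 5), (0, 6)], [(5, 0), (4, 6)]]
  | _ => [[(0, 1), (3, 4)], [(1, 2), (5, 6)], [(2, 3), (5, 0)], [(4, 5), (0, 6)]]

/-- Color classes of a cycle of length seven with the chord from `0` to `t`. -/
def chordClasses : ℕ → List (List (ℕ × ℕ))
  | 2 => [[(0, 1), (2, 3)], [(1, 2), (5, 6)], [(3, 4), (6, 0)], [(4, 5), (0, 2)]]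
  | 3 => [[(0, 1), (2, 3)], [(1, 2), (4, 5), (0, 3)], [(3, 4), (5, 6)], [(6, 0)]]
  | 4 => [[(0, 1), (2, 3)], [(1, 2), (3, 4)], [(4, 5), (6, 0)], [(5, 6), (0, 4)]]
  | _ => [[(0, 1), (3, 4)], [(1, 2), (5, 6)], [(2, 3), (0, 5)], [(4, 5), (6, 0)]]

theorem rainbowClasses_apex : ∀ t < 6, 1 ≤ t → RainbowClasses 7 (apexClasses t) := by
  decide +kernel

theorem rainbowClasses_chord : ∀ t < 6, 2 ≤ t → RainbowClasses 7 (chordClasses t) := by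
  decide +kernel

/-- All that the lifting needs to know of the tables: four colors, and only edges of the intended
minor. -/
theorem mem_apexClasses : ∀ t < 6, 1 ≤ t → (apexClasses t).length = 4 ∧
    ∀ p ∈ (apexClasses t).flatten,
      (p.2 = p.1 + 1 ∧ p.1 < 5) ∨ p = (5, 0) ∨ p = (0, 6) ∨ p = (t, 6) := by
  decide +kernel

theorem mem_chordClasses : ∀ t < 6, 2 ≤ t → (chordClasses t).length = 4 ∧
    ∀ p ∈ (chordClasses t).flatten,
      (p.2 = p.1 + 1 ∧ p.1 < 6) ∨ p = (6, 0) ∨ p = (0, t) := by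
  decide +kernel

end Check

/-! ### Longest cycles and ears in graphs without a cut vertex -/

section Biconnected

variable {V : Type*} {G : SimpleGraph V}

/-- The edges of `G` that avoid `C`. -/
def offGraph (G : SimpleGraph V) (C : Set V) : SimpleGraph V where
  Adj a b := G.Adj a b ∧ a ∉ C ∧ b ∉ C
  symm := ⟨fun _ _ h => ⟨h.1.symm, h.2.2, h.2.1⟩⟩
  loopless := ⟨fun _ h => h.1.ne rfl⟩

/-- A connected graph without a cut vertex. -/
def IsBiconnected (G : SimpleGraph V) : Prop :=
  G.Connected ∧ ∀ v x y, x ≠ v → y ≠ v → (offGraph G {v}).Reachable x y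

theorem notMem_of_offGraph_reachable {C : Set V} {x y : V} (hx : x ∉ C)
    (h : (offGraph G C).Reachable x y) : y ∉ C := by
  obtain ⟨p⟩ := h
  induction p with
  | nil => exact hx
  | cons h _ ih => exact ih h.2.2

/-- A walk from `z` to `c` avoiding `v` must leave the component of `z` outside `C`, and it can do
so only by stepping into `C`. -/
theorem IsBiconnected.exists_exit (hG : G.IsBiconnected) {C : Set V} {z v c : V} (hz : z ∉ C)
    (hvz : z ≠ v) (hc : c ∈ C) (hcv : c ≠ v) :
    ∃ y b, b ∈ C ∧ (offGraph G C).Reachable z y ∧ G.Adj y b ∧ y ≠ v ∧ b ≠ v := by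
  obtain ⟨p⟩ := hG.2 v z c hvz hcv
  obtain ⟨⟨⟨y, b⟩, h⟩, -, hy, hb⟩ := p.exists_boundary_dart {w | (offGraph G C).Reachable z w}
    (Reachable.refl z) (fun h => notMem_of_offGraph_reachable hz h hc)
  refine ⟨y, b, ?_, hy, h.1, h.2.1, h.2.2⟩
  by_contra hbC
  exact hb (hy.trans (Adj.reachable ⟨h.1, notMem_of_offGraph_reachable hz hy, hbC⟩))

/-- A vertex outside `C` lies in an ear with distinct ends in `C`. -/
theorem IsBiconnected.exists_ear (hG : G.IsBiconnected) {C : Set V} {z c c' : V} (hz : z ∉ C)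
    (hc : c ∈ C) (hc' : c' ∈ C) (hcc : c ≠ c') : ∃ x y a b, a ∈ C ∧ b ∈ C ∧ a ≠ b ∧
      (offGraph G C).Reachable z x ∧ (offGraph G C).Reachable z y ∧ G.Adj a x ∧ G.Adj y b := by
  obtain ⟨x, a, ha, hx, hxa, -, -⟩ :=
    hG.exists_exit hz (fun h => hz (h ▸ hc')) hc hcc
  obtain ⟨d, hd, hda⟩ : ∃ d ∈ C, d ≠ a := by
    by_cases h : c = a
    · exact ⟨c', hc', fun h' => hcc (h.trans h'.symm)⟩
    · exact ⟨c, hc, h⟩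
  -- A second exit that avoids `a` ends at another vertex of `C`.
  obtain ⟨y, b, hb, hy, hyb, -, hba⟩ := hG.exists_exit hz (fun h => hz (h ▸ ha)) hd hda
  exact ⟨x, y, a, b, ha, hb, hba.symm, hx, hy, hxa.symm, hyb⟩

/-- If the outside vertex has a neighbor outside `C`, then the ear can be taken with at least two
interior vertices. -/
theorem IsBiconnected.exists_long_ear (hG : G.IsBiconnected) {C : Set V} {z z' c c' : V}
    (hz : z ∉ C) (hz' : z' ∉ C) (hzz : G.Adj z z') (hc : c ∈ C) (hc' : c' ∈ C) (hcc : c ≠ c') :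
    ∃ x y a b, a ∈ C ∧ b ∈ C ∧ a ≠ b ∧ x ≠ y ∧
      (offGraph G C).Reachable z x ∧ (offGraph G C).Reachable z y ∧ G.Adj a x ∧ G.Adj y b := by
  obtain ⟨x, y, a, b, ha, hb, hab, hx, hy, hax, hyb⟩ := hG.exists_ear hz hc hc' hcc
  by_cases hxy : x = y
  · subst hxy
    obtain ⟨w, hzw, hwx⟩ : ∃ w, (offGraph G C).Reachable z w ∧ w ≠ x := by
      by_cases h : z = x
      · exact ⟨z', Adj.reachable ⟨hzz, hz, hz'⟩, fun h' => hzz.ne (h.trans h'.symm)⟩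
      · exact ⟨z, Reachable.refl z, h⟩
    -- Here `x` is attached to both `a` and `b`. A second vertex `w` of the component has an exit
    -- through some `u ≠ x` to `d`, and at least one of `a`, `b` differs from `d`.
    obtain ⟨u, d, hd, hu, hud, hux, -⟩ := hG.exists_exit (v := x)
      (notMem_of_offGraph_reachable hz hzw) hwx ha
      (fun h => notMem_of_offGraph_reachable hz hx (h ▸ ha))
    by_cases hda : d = a
    · subst hda
      exact ⟨u, x, d, b, ha, hb, hab, hux, hzw.trans hu, hx, hud.symm, hyb⟩
    · exact ⟨u, x, d, a, hd, ha, hda, hux, hzw.trans hu, hx, hud.symm, hax.symm⟩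
  · exact ⟨x, y, a, b, ha, hb, hab, hxy, hx, hy, hax, hyb⟩

/-- The list is the vertex sequence of a cycle (or of an edge, traversed back and forth). -/
def IsCycleList (G : SimpleGraph V) (l : List V) : Prop :=
  l.Nodup ∧ l.IsChain G.Adj ∧ ∀ x ∈ l.getLast?, ∀ y ∈ l.head?, G.Adj x y

theorem exists_path_list {C : Set V} {x y : V} (hx : x ∉ C) (h : (offGraph G C).Reachable x y) :
    ∃ q : List V, q.Nodup ∧ q.IsChain G.Adj ∧ q.head? = some x ∧ q.getLast? = some y ∧
      ∀ v ∈ q, v ∉ C := by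
  classical
  obtain ⟨p, hp⟩ := h.exists_isPath
  refine ⟨p.support, hp.support_nodup, p.isChain_adj_support.imp fun _ _ h => h.1, ?_, ?_, ?_⟩
  · rw [List.head?_eq_some_head p.support_ne_nil, Walk.head_support]
  · rw [List.getLast?_eq_some_getLast p.support_ne_nil, Walk.getLast_support]
  · intro v hv
    exact notMem_of_offGraph_reachable hx (p.takeUntil v hv).reachable

theorem isCycleList_append {l q : List V} {a b x y : V} (hl : l.Nodup) (hlc : l.IsChain G.Adj)
    (hq : q.Nodup) (hqc : q.IsChain G.Adj) (hd : ∀ v ∈ q, v ∉ l) (hb : l.head? = some b)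
    (ha : l.getLast? = some a) (hx : q.head? = some x) (hy : q.getLast? = some y)
    (hax : G.Adj a x) (hyb : G.Adj y b) : IsCycleList G (l ++ q) := by
  refine ⟨List.nodup_append'.2 ⟨hl, hq, fun v hv hv' => hd v hv' hv⟩,
    List.isChain_append.2 ⟨hlc, hqc, ?_⟩, ?_⟩
  · rintro u hu w hw
    simp only [ha, hx, Option.mem_def, Option.some.injEq] at hu hw
    subst hu hw
    exact hax
  · rw [List.getLast?_append, List.head?_append, hy, hb]
    rintro u hu w hw
    simp only [Option.some_or, Option.mem_def, Option.some.injEq] at hu hw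
    subst hu hw
    exact hyb

theorem IsCycleList.rotate {l q : List V} (h : IsCycleList G (l ++ q)) :
    IsCycleList G (q ++ l) := by
  obtain ⟨h1, h2, h3⟩ := h
  rcases l.eq_nil_or_concat with rfl | ⟨l', a, rfl⟩
  · simpa using ⟨h1, h2, h3⟩
  rw [List.concat_eq_append] at *
  rcases q with _ | ⟨b, q'⟩
  · rw [List.append_nil] at h1 h2 h3
    exact ⟨h1, h2, h3⟩
  rw [List.isChain_append] at h2
  refine ⟨List.nodup_append_comm.1 h1, List.isChain_append.2 ⟨h2.2.1, h2.1, ?_⟩, ?_⟩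
  · intro x hx y hy
    refine h3 x ?_ y ?_
    · rw [List.getLast?_append, hx]
      rfl
    · rw [List.head?_append, hy]
      rfl
  · intro x hx y hy
    refine h2.2.2 x ?_ y ?_
    · rw [List.getLast?_append] at hx
      simpa using hx
    · simpa using hy

theorem IsCycleList.exists_cons {l : List V} (h : IsCycleList G l) {a : V} (ha : a ∈ l) :
    ∃ l', IsCycleList G (a :: l') ∧ (a :: l').length = l.length ∧ ∀ v, v ∈ a :: l' ↔ v ∈ l := by
  obtain ⟨s, t, rfl⟩ := List.append_of_mem ha
  refine ⟨t ++ s, h.rotate, by simp; omega, fun v => ?_⟩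
  simp only [List.mem_cons, List.mem_append]
  tauto

theorem exists_maximal_isCycleList [Fintype V] {l : List V} (h : IsCycleList G l) :
    ∃ l', IsCycleList G l' ∧ l.length ≤ l'.length ∧
      ∀ l'', IsCycleList G l'' → l''.length ≤ l'.length := by
  classical
  let P : ℕ → Prop := fun n => ∃ l, IsCycleList G l ∧ l.length = n
  have hb : ∀ l, IsCycleList G l → l.length ≤ Fintype.card V := fun l h =>
    h.1.length_le_card
  obtain ⟨l', h1, h2⟩ := Nat.findGreatest_spec (P := P) (hb l h) ⟨l, h, rfl⟩
  refine ⟨l', h1, ?_, fun l'' h'' => ?_⟩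
  · rw [h2]
    exact Nat.le_findGreatest (hb l h) ⟨l, h, rfl⟩
  · rw [h2]
    exact Nat.le_findGreatest (hb l'' h'') ⟨l'', h'', rfl⟩

theorem IsCycleList.getElem_adj {l : List V} (h : IsCycleList G l) {i : ℕ}
    (hi : i + 1 < l.length) : G.Adj l[i] l[i + 1] :=
  List.isChain_iff_getElem.1 h.2.1 i hi

theorem IsCycleList.closing_adj {l : List V} (h : IsCycleList G l) (h0 : 0 < l.length) :
    G.Adj (l[l.length - 1]'(by omega)) l[0] :=
  h.2.2 _ (by simp [List.getLast?_eq_getElem?]) _ (by simp [List.head?_eq_getElem?])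

/-- The cycle is contracted to a 4-cycle: three vertices stay, the remaining arc becomes the fourth.
-/
theorem IsCycleList.hasRainbow_four [Fintype V] {l : List V} {m : ℕ} (h : IsCycleList G l)
    (hG : G.Connected) (hl : 4 ≤ l.length) (hm : Fintype.card V ≤ m + 2) :
    HasRainbow G Set.univ m := by
  refine rainbowClasses_cycle_four.of_list hG h.1 (fun hn => by simp [hn] at hl)
    (fun i => min i 3) (fun i _ => by omega) (fun w hw => ⟨w, by omega, by omega⟩) ?_ ?_
    (by simp; omega)
  · intro i j hij hj h'
    refine ⟨by omega, ?_⟩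
    have := h.getElem_adj (i := j - 1) (by omega)
    simpa only [Nat.sub_add_cancel (show 1 ≤ j by omega)] using this
  · intro p hp
    have h01 := h.getElem_adj (i := 0) (by omega)
    have h12 := h.getElem_adj (i := 1) (by omega)
    have h23 := h.getElem_adj (i := 2) (by omega)
    have hc := h.closing_adj (by omega)
    simp only [List.flatten_cons, List.flatten_nil, List.cons_append, List.nil_append,
      List.mem_cons, List.not_mem_nil, or_false] at hp
    rcases hp with rfl | rfl | rfl | rfl
    · exact ⟨0, 1, by omega, by omega, rfl, rfl, h01⟩
    · exact ⟨2, 3, by omega, by omega, rfl, rfl, h23⟩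
    · exact ⟨1, 2, by omega, by omega, rfl, rfl, h12⟩
    · exact ⟨l.length - 1, 0, by omega, by omega, by simp; omega, rfl, hc⟩

theorem IsCycleList.hasRainbow_chord [Fintype V] {l : List V} {m : ℕ} (h : IsCycleList G l)
    (hG : G.Connected) (hl : 7 ≤ l.length) {j : ℕ} (h2 : 2 ≤ j) (hj : j + 1 < l.length)
    (hadj : G.Adj l[0] l[j]) (hm : Fintype.card V ≤ m + 3) : HasRainbow G Set.univ m := by
  -- The chord splits the cycle into arcs of `j` and `l.length - j` edges, which are shortened to
  -- `t` and `r + 1 = 7 - t` edges. The map `min i t + min (i - j) r` counts along both arcs,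
  -- stopping at `t` until index `j` and finally at `6`.
  obtain ⟨t, r, ht6, ht2, htr, htj, hr⟩ : ∃ t r, t < 6 ∧ 2 ≤ t ∧ t + r = 6 ∧ t ≤ j ∧
      r + j + 1 ≤ l.length := by
    by_cases h5 : j ≤ 5
    · exact ⟨j, 6 - j, by omega, by omega, by omega, by omega, by omega⟩
    · exact ⟨5, 1, by omega, by omega, by omega, by omega, by omega⟩
  obtain ⟨hlen, hmem⟩ := mem_chordClasses t ht6 ht2
  refine (rainbowClasses_chord t ht6 ht2).of_list hG h.1 (fun hn => by simp [hn] at hl)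
    (fun i => min i t + min (i - j) r) (fun i _ => by omega) (fun w hw => ?_) ?_ ?_
    (by rw [hlen]; omega)
  · by_cases hwt : w ≤ t
    · exact ⟨w, by omega, by omega⟩
    · exact ⟨j + (w - t), by omega, by omega⟩
  · intro i k hik hk h'
    refine ⟨by omega, ?_⟩
    have := h.getElem_adj (i := k - 1) (by omega)
    simpa only [Nat.sub_add_cancel (show 1 ≤ k by omega)] using this
  · rintro ⟨p, q⟩ hp
    rcases hmem _ hp with ⟨h1, h3⟩ | h1 | h1
    · simp only at h1 h3
      by_cases hpt : p < t
      · exact ⟨p, p + 1, by omega, by omega, by simp only; omega, by simp only; omega,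
          h.getElem_adj _⟩
      · exact ⟨j + (p - t), j + (p - t) + 1, by omega, by omega, by simp only; omega,
          by simp only; omega, h.getElem_adj _⟩
    · simp only [Prod.mk.injEq] at h1
      exact ⟨l.length - 1, 0, by omega, by omega, by simp only; omega, by simp only; omega,
        h.closing_adj _⟩
    · simp only [Prod.mk.injEq] at h1
      exact ⟨0, j, by omega, by omega, by simp only; omega, by simp only; omega, hadj⟩

/-- The arcs are shortened as for a chord, now to a 6-cycle, and the interior `q` of the ear becomes
vertex `6`. -/
theorem IsCycleList.hasRainbow_apex [Fintype V] {l q : List V} {x y : V} {m : ℕ}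
    (h : IsCycleList G l) (hG : G.Connected) (hl : 6 ≤ l.length) {j : ℕ} (h1 : 1 ≤ j)
    (hj : j < l.length) (hq : q.Nodup) (hqc : q.IsChain G.Adj) (hd : ∀ v ∈ q, v ∉ l)
    (hx : q.head? = some x) (hy : q.getLast? = some y) (hax : G.Adj l[0] x)
    (hyb : G.Adj y l[j]) (hm : Fintype.card V ≤ m + 3) : HasRainbow G Set.univ m := by
  have hq0 : q ≠ [] := fun hn => by simp [hn] at hx
  have hqpos := List.length_pos_of_ne_nil hq0
  have hx' : q[0] = x := by
    rw [List.head?_eq_getElem?, List.getElem?_eq_getElem hqpos] at hx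
    exact Option.some.inj hx
  have hy' : q[q.length - 1] = y := by
    rw [List.getLast?_eq_getElem?, List.getElem?_eq_getElem (by omega)] at hy
    exact Option.some.inj hy
  obtain ⟨t, r, ht6, ht1, htr, htj, hr⟩ : ∃ t r, t < 6 ∧ 1 ≤ t ∧ t + r = 5 ∧ t ≤ j ∧
      r + j + 1 ≤ l.length := by
    by_cases h5 : j ≤ 5
    · exact ⟨j, 5 - j, by omega, by omega, by omega, by omega, by omega⟩
    · exact ⟨5, 0, by omega, by omega, by omega, by omega, by omega⟩
  obtain ⟨hlen, hmem⟩ := mem_apexClasses t ht6 ht1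
  have hL : (l ++ q).length = l.length + q.length := List.length_append
  have hgl : ∀ i (hi : i < l.length), (l ++ q)[i]'(by omega) = l[i] := fun i hi =>
    List.getElem_append_left hi
  have hgq : ∀ i (hi : i < q.length), (l ++ q)[l.length + i]'(by omega) = q[i] := fun i hi => by
    rw [List.getElem_append_right (by omega)]
    simp
  let g : ℕ → ℕ := fun i => if i < l.length then min i t + min (i - j) r else 6
  have hg1 : ∀ i < l.length, g i = min i t + min (i - j) r := fun i hi => if_pos hi
  have hg2 : ∀ i, l.length ≤ i → g i = 6 := fun i hi => if_neg (by omega)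
  refine (rainbowClasses_apex t ht6 ht1).of_list hG (l := l ++ q)
    (List.nodup_append'.2 ⟨h.1, hq, fun v hv hv' => hd v hv' hv⟩) (by simp [hq0]) g
    (fun i _ => ?_) (fun w hw => ?_) ?_ ?_ (by rw [hlen]; omega)
  · simp only [g]
    split_ifs <;> omega
  · by_cases hw6 : w = 6
    · exact ⟨l.length, by omega, by rw [hg2 _ le_rfl, hw6]⟩
    by_cases hwt : w ≤ t
    · exact ⟨w, by omega, by rw [hg1 _ (by omega)]; omega⟩
    · exact ⟨j + (w - t), by omega, by rw [hg1 _ (by omega)]; omega⟩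
  · intro i k hik hk h'
    by_cases hkl : k < l.length
    · rw [hg1 i (by omega), hg1 k hkl] at h'
      refine ⟨by rw [hg1 k hkl, hg1 _ (by omega)]; omega, ?_⟩
      rw [hgl k hkl, hgl (k - 1) (by omega)]
      have := h.getElem_adj (i := k - 1) (by omega)
      simpa only [Nat.sub_add_cancel (show 1 ≤ k by omega)] using this
    · have hil : l.length ≤ i := by
        by_contra hil
        rw [hg1 i (by omega), hg2 k (by omega)] at h'
        omega
      refine ⟨by rw [hg2 k (by omega), hg2 _ (by omega)], ?_⟩
      obtain ⟨s, rfl⟩ := Nat.exists_eq_add_of_lt (show l.length < k by omega)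
      have := List.isChain_iff_getElem.1 hqc s (by omega)
      rw [← hgq s (by omega), ← hgq (s + 1) (by omega)] at this
      exact this
  · rintro ⟨p, p'⟩ hp
    rcases hmem _ hp with ⟨e1, e3⟩ | e1 | e1 | e1
    · simp only at e1 e3
      by_cases hpt : p < t
      · refine ⟨p, p + 1, by omega, by omega, by rw [hg1 _ (by omega)]; simp only; omega,
          by rw [hg1 _ (by omega)]; simp only; omega, ?_⟩
        rw [hgl _ (by omega), hgl _ (by omega)]
        exact h.getElem_adj _
      · refine ⟨j + (p - t), j + (p - t) + 1, by omega, by omega,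
          by rw [hg1 _ (by omega)]; simp only; omega,
          by rw [hg1 _ (by omega)]; simp only; omega, ?_⟩
        rw [hgl _ (by omega), hgl _ (by omega)]
        exact h.getElem_adj _
    · simp only [Prod.mk.injEq] at e1
      refine ⟨l.length - 1, 0, by omega, by omega, by rw [hg1 _ (by omega)]; simp only; omega,
        by rw [hg1 _ (by omega)]; simp only; omega, ?_⟩
      rw [hgl _ (by omega), hgl _ (by omega)]
      exact h.closing_adj _
    · simp only [Prod.mk.injEq] at e1
      refine ⟨0, l.length, by omega, by omega, by rw [hg1 _ (by omega)]; simp only; omega,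
        by rw [hg2 _ le_rfl]; simp only; omega, ?_⟩
      rw [hgl _ (by omega)]
      have := hgq 0 hqpos
      simp only [Nat.add_zero] at this
      rw [this, hx']
      exact hax
    · simp only [Prod.mk.injEq] at e1
      refine ⟨j, l.length + (q.length - 1), by omega, by omega,
        by rw [hg1 _ (by omega)]; simp only; omega,
        by rw [hg2 _ (by omega)]; simp only; omega, ?_⟩
      rw [hgl _ (by omega), hgq _ (by omega), hy']
      exact hyb.symm

/-- Two vertices of a cycle split it into two arcs. -/
theorem IsCycleList.exists_arcs {l : List V} (h : IsCycleList G l) {a b : V} (ha : a ∈ l)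
    (hb : b ∈ l) (hab : a ≠ b) : ∃ s s' : List V, s.length + s'.length = l.length + 2 ∧
      ∀ t ∈ [s, s'], t.Nodup ∧ t.IsChain G.Adj ∧ t.head? = some b ∧ t.getLast? = some a ∧
        ∀ v ∈ t, v ∈ l := by
  obtain ⟨l', h', hlen, hmem⟩ := h.exists_cons ha
  have hb' : b ∈ l' := by
    have := (hmem b).2 hb
    rcases List.mem_cons.1 this with h | h
    · exact absurd h.symm hab
    · exact h
  obtain ⟨s₁, s₂, rfl⟩ := List.append_of_mem hb'
  have hr : IsCycleList G ((b :: s₂) ++ (a :: s₁)) := by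
    have : IsCycleList G ((a :: s₁) ++ (b :: s₂)) := by simpa using h'
    exact this.rotate
  refine ⟨(b :: s₂) ++ [a], ((a :: s₁) ++ [b]).reverse, by simp at hlen ⊢; omega, ?_⟩
  intro t ht
  simp only [List.mem_cons, List.not_mem_nil, or_false] at ht
  rcases ht with rfl | rfl
  · have hsub : ((b :: s₂) ++ [a]) <+: ((b :: s₂) ++ (a :: s₁)) := ⟨s₁, by simp⟩
    refine ⟨hr.1.sublist hsub.sublist, hr.2.1.prefix hsub, by simp,
      by rw [List.getLast?_append]; simp, fun v hv => (hmem v).1 ?_⟩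
    simp only [List.mem_append, List.mem_cons, List.not_mem_nil, or_false] at hv ⊢
    tauto
  · have hsub : ((a :: s₁) ++ [b]) <+: (a :: (s₁ ++ b :: s₂)) := ⟨s₂, by simp⟩
    refine ⟨List.nodup_reverse.2 (h'.1.sublist hsub.sublist), ?_, ?_, ?_, fun v hv =>
      (hmem v).1 ?_⟩
    · rw [List.isChain_reverse]
      exact (h'.2.1.prefix hsub).imp fun _ _ h => h.symm
    · rw [List.head?_reverse, List.getLast?_append]
      simp
    · rw [List.getLast?_reverse]
      simp
    · simp only [List.mem_reverse, List.mem_append, List.mem_cons, List.not_mem_nil,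
        or_false] at hv ⊢
      tauto

/-- An ear of a longest cycle is short. -/
theorem IsCycleList.ear_le {l q : List V} {a b x y : V} (h : IsCycleList G l)
    (hmax : ∀ l', IsCycleList G l' → l'.length ≤ l.length) (ha : a ∈ l) (hb : b ∈ l)
    (hab : a ≠ b) (hq : q.Nodup) (hqc : q.IsChain G.Adj) (hd : ∀ v ∈ q, v ∉ l)
    (hx : q.head? = some x) (hy : q.getLast? = some y) (hax : G.Adj a x) (hyb : G.Adj y b) :
    2 * q.length + 2 ≤ l.length := by
  obtain ⟨s, s', hss, hs⟩ := h.exists_arcs ha hb hab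
  -- Replacing either arc by the ear gives a cycle, no longer than the longest. The arcs share both
  -- ends, so adding the two inequalities gives the claim.
  have key : ∀ t ∈ [s, s'], t.length + q.length ≤ l.length := by
    intro t ht
    obtain ⟨h1, h2, h3, h4, h5⟩ := hs t ht
    rw [← List.length_append]
    exact hmax _ (isCycleList_append h1 h2 hq hqc (fun v hv hv' => hd v hv (h5 v hv')) h3 h4 hx hy
      hax hyb)
  have := key s (by simp)
  have := key s' (by simp)
  omega

theorem exists_pair_mem_of_two_le {l : List V} (hl : l.Nodup) (h2 : 2 ≤ l.length) :
    ∃ c ∈ l, ∃ c' ∈ l, c ≠ c' := by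
  refine ⟨l[0], List.getElem_mem _, l[1], List.getElem_mem _, fun h => ?_⟩
  have := hl.getElem_inj_iff.1 h
  omega

/-- A longest cycle that does not span a biconnected graph has length at least four. -/
theorem IsBiconnected.four_le_length (hG : G.IsBiconnected) {l : List V} (h : IsCycleList G l)
    (h2 : 2 ≤ l.length) (hmax : ∀ l', IsCycleList G l' → l'.length ≤ l.length) {z : V}
    (hz : z ∉ l) : 4 ≤ l.length := by
  obtain ⟨c, hc, c', hc', hcc⟩ := exists_pair_mem_of_two_le h.1 h2
  obtain ⟨x, y, a, b, ha, hb, hab, hx, hy, hax, hyb⟩ :=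
    hG.exists_ear (C := {v | v ∈ l}) hz hc hc' hcc
  have hxC := notMem_of_offGraph_reachable (C := {v | v ∈ l}) hz hx
  obtain ⟨q, hq, hqc, hqx, hqy, hqd⟩ := exists_path_list hxC (hx.symm.trans hy)
  have := h.ear_le hmax ha hb hab hq hqc hqd hqx hqy hax hyb
  have : 0 < q.length := List.length_pos_of_ne_nil fun hn => by simp [hn] at hqx
  omega

/-- Outside a longest cycle of length at most five, each vertex has two neighbors on the cycle. -/
theorem IsBiconnected.exists_two_neighbors (hG : G.IsBiconnected) {l : List V}
    (h : IsCycleList G l) (h2 : 2 ≤ l.length) (h5 : l.length ≤ 5)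
    (hmax : ∀ l', IsCycleList G l' → l'.length ≤ l.length) {z : V} (hz : z ∉ l) :
    ∃ a ∈ l, ∃ b ∈ l, a ≠ b ∧ G.Adj z a ∧ G.Adj z b := by
  obtain ⟨c, hc, c', hc', hcc⟩ := exists_pair_mem_of_two_le h.1 h2
  -- A neighbor outside the cycle would yield an ear with at least two interior vertices, forcing
  -- length at least six by `ear_le`.
  have hiso : ∀ z', z' ∉ l → ¬ G.Adj z z' := by
    intro z' hz' hzz
    obtain ⟨x, y, a, b, ha, hb, hab, hxy, hx, hy, hax, hyb⟩ :=
      hG.exists_long_ear (C := {v | v ∈ l}) hz hz' hzz hc hc' hcc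
    have hxC := notMem_of_offGraph_reachable (C := {v | v ∈ l}) hz hx
    obtain ⟨q, hq, hqc, hqx, hqy, hqd⟩ := exists_path_list hxC (hx.symm.trans hy)
    have := h.ear_le hmax ha hb hab hq hqc hqd hqx hqy hax hyb
    have : 2 ≤ q.length := by
      rcases q with _ | ⟨u, _ | ⟨v, q⟩⟩
      · simp at hqx
      · simp only [List.head?_cons, Option.some.injEq, List.getLast?_singleton] at hqx hqy
        exact absurd (hqx.symm.trans hqy) hxy
      · simp
    omega
  have hr : ∀ w, (offGraph G {v | v ∈ l}).Reachable z w → w = z := by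
    rintro w ⟨p⟩
    cases p with
    | nil => rfl
    | cons h _ => exact absurd h.1 (hiso _ h.2.2)
  obtain ⟨x, y, a, b, ha, hb, hab, hx, hy, hax, hyb⟩ :=
    hG.exists_ear (C := {v | v ∈ l}) hz hc hc' hcc
  rw [hr x hx] at hax
  rw [hr y hy] at hyb
  exact ⟨a, ha, b, hb, hab, hax.symm, hyb⟩

theorem hasRainbow_of_bipartite [Fintype V] (hG : G.Connected) {h h' p q r s : V} {m : ℕ}
    (hn : [h, h', p, q, r, s].Nodup) (hp : G.Adj h p ∧ G.Adj h' p) (hq : G.Adj h q ∧ G.Adj h' q)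
    (hr : G.Adj h r ∧ G.Adj h' r) (hs : G.Adj h s ∧ G.Adj h' s) (hm : Fintype.card V ≤ m + 3) :
    HasRainbow G Set.univ m := by
  refine rainbowClasses_completeBipartite.of_list hG hn (by simp) (fun i => i)
    (fun i hi => by simpa using hi) (fun w hw => ⟨w, by simpa using hw, rfl⟩)
    (fun i j hij _ h => by omega) ?_ (by simp; omega)
  intro e he
  simp only [List.flatten_cons, List.flatten_nil, List.cons_append, List.nil_append,
    List.mem_cons, List.not_mem_nil, or_false] at he
  rcases he with rfl | rfl | rfl | rfl | rfl | rfl | rfl | rfl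
  · exact ⟨0, 2, by simp, by simp, rfl, rfl, hp.1⟩
  · exact ⟨0, 3, by simp, by simp, rfl, rfl, hq.1⟩
  · exact ⟨1, 4, by simp, by simp, rfl, rfl, hr.2⟩
  · exact ⟨1, 5, by simp, by simp, rfl, rfl, hs.2⟩
  · exact ⟨0, 4, by simp, by simp, rfl, rfl, hr.1⟩
  · exact ⟨1, 2, by simp, by simp, rfl, rfl, hp.2⟩
  · exact ⟨0, 5, by simp, by simp, rfl, rfl, hs.1⟩
  · exact ⟨1, 3, by simp, by simp, rfl, rfl, hq.2⟩

/-- Contracting the edge `st` gives `K_{2,4}`. -/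
theorem hasRainbow_of_bipartite_subdivided [Fintype V] (hG : G.Connected)
    {h h' p q r s t : V} {m : ℕ} (hn : [h, h', p, q, r, s, t].Nodup)
    (hp : G.Adj h p ∧ G.Adj h' p) (hq : G.Adj h q ∧ G.Adj h' q)
    (hr : G.Adj h r ∧ G.Adj h' r) (hs : G.Adj h s) (hst : G.Adj s t) (ht : G.Adj h' t)
    (hm : Fintype.card V ≤ m + 3) : HasRainbow G Set.univ m := by
  refine rainbowClasses_completeBipartite.of_list hG hn (by simp) (fun i => min i 5)
    (fun i hi => by omega) (fun w hw => ⟨w, by simp; omega, by omega⟩) ?_ ?_ (by simp; omega)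
  · intro i j hij hj h
    simp only [List.length_cons, List.length_nil] at hj
    obtain rfl : i = 5 := by omega
    obtain rfl : j = 6 := by omega
    exact ⟨rfl, hst⟩
  intro e he
  simp only [List.flatten_cons, List.flatten_nil, List.cons_append, List.nil_append,
    List.mem_cons, List.not_mem_nil, or_false] at he
  rcases he with rfl | rfl | rfl | rfl | rfl | rfl | rfl | rfl
  · exact ⟨0, 2, by simp, by simp, rfl, rfl, hp.1⟩
  · exact ⟨0, 3, by simp, by simp, rfl, rfl, hq.1⟩
  · exact ⟨1, 4, by simp, by simp, rfl, rfl, hr.2⟩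
  · exact ⟨1, 6, by simp, by simp, rfl, rfl, ht⟩
  · exact ⟨0, 4, by simp, by simp, rfl, rfl, hr.1⟩
  · exact ⟨1, 2, by simp, by simp, rfl, rfl, hp.2⟩
  · exact ⟨0, 5, by simp, by simp, rfl, rfl, hs⟩
  · exact ⟨1, 3, by simp, by simp, rfl, rfl, hq.2⟩

/-- Contracting the edge `uu'` gives `K_{2,4}`. -/
theorem hasRainbow_of_bipartite_split [Fintype V] (hG : G.Connected)
    {h u u' p q r s : V} {m : ℕ} (hn : [h, u, u', p, q, r, s].Nodup) (huu : G.Adj u u')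
    (hp : G.Adj h p ∧ G.Adj u p) (hq : G.Adj h q ∧ G.Adj u q)
    (hr : G.Adj h r ∧ G.Adj u' r) (hs : G.Adj h s ∧ G.Adj u' s)
    (hm : Fintype.card V ≤ m + 3) : HasRainbow G Set.univ m := by
  refine rainbowClasses_completeBipartite.of_list hG hn (by simp)
    (fun i => min i 1 + (i - 2)) (fun i hi => by simp at hi; omega) (fun w hw => ?_) ?_ ?_
    (by simp; omega)
  · by_cases hw1 : w ≤ 1
    · exact ⟨w, by simp; omega, by omega⟩
    · exact ⟨w + 1, by simp; omega, by omega⟩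
  · intro i j hij hj h
    simp only [List.length_cons, List.length_nil] at hj
    obtain rfl : i = 1 := by omega
    obtain rfl : j = 2 := by omega
    exact ⟨rfl, huu⟩
  intro e he
  simp only [List.flatten_cons, List.flatten_nil, List.cons_append, List.nil_append,
    List.mem_cons, List.not_mem_nil, or_false] at he
  rcases he with rfl | rfl | rfl | rfl | rfl | rfl | rfl | rfl
  · exact ⟨0, 3, by simp, by simp, rfl, rfl, hp.1⟩
  · exact ⟨0, 4, by simp, by simp, rfl, rfl, hq.1⟩
  · exact ⟨2, 5, by simp, by simp, rfl, rfl, hr.2⟩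
  · exact ⟨2, 6, by simp, by simp, rfl, rfl, hs.2⟩
  · exact ⟨0, 5, by simp, by simp, rfl, rfl, hr.1⟩
  · exact ⟨1, 3, by simp, by simp, rfl, rfl, hp.2⟩
  · exact ⟨0, 6, by simp, by simp, rfl, rfl, hs.1⟩
  · exact ⟨1, 4, by simp, by simp, rfl, rfl, hq.2⟩

/-- If the two neighbors of `w` are consecutive on the cycle, or are `v₁` with `v₃` or `v₄`, there
is a 6-cycle, in the latter case through `z`. The pair `v₀, v₂` gives a `K_{2,4}` with a subdivided
edge; `v₀, v₃` and `v₂, v₄` give one with a split hub. -/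
theorem hasRainbow_of_five_cycle [Fintype V] (hG : G.Connected) {v₀ v₁ v₂ v₃ v₄ z w : V} {m : ℕ}
    (h : IsCycleList G [v₀, v₁, v₂, v₃, v₄])
    (hmax : ∀ l, IsCycleList G l → l.length ≤ 5) (hz : z ∉ [v₀, v₁, v₂, v₃, v₄])
    (hw : w ∉ [v₀, v₁, v₂, v₃, v₄]) (hwz : w ≠ z) (hz₀ : G.Adj z v₀) (hz₂ : G.Adj z v₂) {a b : V}
    (ha : a ∈ [v₀, v₁, v₂, v₃, v₄]) (hb : b ∈ [v₀, v₁, v₂, v₃, v₄]) (hab : a ≠ b)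
    (hwa : G.Adj w a) (hwb : G.Adj w b) (hm : Fintype.card V ≤ m + 3) :
    HasRainbow G Set.univ m := by
  obtain ⟨hn, hc, hl⟩ := h
  have hcl : G.Adj v₄ v₀ := hl _ (by simp) _ (by simp)
  simp only [List.isChain_cons_cons, List.isChain_singleton, and_true] at hc
  obtain ⟨h01, h12, h23, h34⟩ := hc
  simp only [List.nodup_cons, List.mem_cons, List.not_mem_nil, or_false, not_or, not_false_eq_true,
    List.nodup_nil, and_true] at hn hz hw
  have no : ∀ l : List V, l.length = 6 → ¬ IsCycleList G l := fun l hl hc => by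
    have := hmax l hc
    omega
  have ex : ∀ c₀ c₁ c₂ c₃ c₄ c₅ : V, [c₀, c₁, c₂, c₃, c₄, c₅].Nodup → G.Adj c₀ c₁ → G.Adj c₁ c₂ →
      G.Adj c₂ c₃ → G.Adj c₃ c₄ → G.Adj c₄ c₅ → G.Adj c₅ c₀ → False := by
    intro c₀ c₁ c₂ c₃ c₄ c₅ hn h0 h1 h2 h3 h4 h5
    exact no [c₀, c₁, c₂, c₃, c₄, c₅] rfl ⟨hn, by simp [*], by simp [*]⟩
  have A01 : G.Adj w v₀ → G.Adj w v₁ → False := fun e e' =>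
    ex v₁ v₂ v₃ v₄ v₀ w (by simp; grind) h12 h23 h34 hcl e.symm e'
  have A12 : G.Adj w v₁ → G.Adj w v₂ → False := fun e e' =>
    ex v₂ v₃ v₄ v₀ v₁ w (by simp; grind) h23 h34 hcl h01 e.symm e'
  have A23 : G.Adj w v₂ → G.Adj w v₃ → False := fun e e' =>
    ex v₃ v₄ v₀ v₁ v₂ w (by simp; grind) h34 hcl h01 h12 e.symm e'
  have A34 : G.Adj w v₃ → G.Adj w v₄ → False := fun e e' =>
    ex v₄ v₀ v₁ v₂ v₃ w (by simp; grind) hcl h01 h12 h23 e.symm e'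
  have A40 : G.Adj w v₄ → G.Adj w v₀ → False := fun e e' =>
    ex v₀ v₁ v₂ v₃ v₄ w (by simp; grind) h01 h12 h23 h34 e.symm e'
  have A13 : G.Adj w v₁ → G.Adj w v₃ → False := fun e e' =>
    ex w v₁ v₀ z v₂ v₃ (by simp; grind) e h01.symm hz₀.symm hz₂ h23 e'.symm
  have A14 : G.Adj w v₁ → G.Adj w v₄ → False := fun e e' =>
    ex w v₁ v₂ z v₀ v₄ (by simp; grind) e h12 hz₂.symm hz₀ hcl.symm e'.symm
  have B02 : G.Adj w v₀ → G.Adj w v₂ → HasRainbow G Set.univ m := fun e e' =>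
    hasRainbow_of_bipartite_subdivided hG (h := v₀) (h' := v₂) (p := v₁) (q := z) (r := w)
      (s := v₄) (t := v₃) (by simp; grind) ⟨h01, h12.symm⟩ ⟨hz₀.symm, hz₂.symm⟩
      ⟨e.symm, e'.symm⟩ hcl.symm h34.symm h23 hm
  have B03 : G.Adj w v₀ → G.Adj w v₃ → HasRainbow G Set.univ m := fun e e' =>
    hasRainbow_of_bipartite_split hG (h := v₀) (u := v₂) (u' := v₃) (p := v₁) (q := z) (r := v₄)
      (s := w) (by simp; grind) h23 ⟨h01, h12.symm⟩ ⟨hz₀.symm, hz₂.symm⟩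
      ⟨hcl.symm, h34⟩ ⟨e.symm, e'.symm⟩ hm
  have B24 : G.Adj w v₂ → G.Adj w v₄ → HasRainbow G Set.univ m := fun e e' =>
    hasRainbow_of_bipartite_split hG (h := v₂) (u := v₀) (u' := v₄) (p := v₁) (q := z) (r := v₃)
      (s := w) (by simp; grind) hcl.symm ⟨h12.symm, h01⟩ ⟨hz₂.symm, hz₀.symm⟩
      ⟨h23, h34.symm⟩ ⟨e.symm, e'.symm⟩ hm
  simp only [List.mem_cons, List.not_mem_nil, or_false] at ha hb
  rcases ha with rfl | rfl | rfl | rfl | rfl <;> rcases hb with rfl | rfl | rfl | rfl | rfl <;>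
    first
    | exact absurd rfl hab
    | exact B02 hwa hwb
    | exact B02 hwb hwa
    | exact B03 hwa hwb
    | exact B03 hwb hwa
    | exact B24 hwa hwb
    | exact B24 hwb hwa
    | exact (A01 hwa hwb).elim
    | exact (A01 hwb hwa).elim
    | exact (A12 hwa hwb).elim
    | exact (A12 hwb hwa).elim
    | exact (A23 hwa hwb).elim
    | exact (A23 hwb hwa).elim
    | exact (A34 hwa hwb).elim
    | exact (A34 hwb hwa).elim
    | exact (A40 hwa hwb).elim
    | exact (A40 hwb hwa).elim
    | exact (A13 hwa hwb).elim
    | exact (A13 hwb hwa).elim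
    | exact (A14 hwa hwb).elim
    | exact (A14 hwb hwa).elim

/-- Only the pair `v₀, v₂` avoids a longer cycle, and then these two are the hubs of a `K_{2,4}`. -/
theorem hasRainbow_of_four_cycle [Fintype V] (hG : G.Connected) {v₀ v₁ v₂ v₃ z w : V} {m : ℕ}
    (h : IsCycleList G [v₀, v₁, v₂, v₃])
    (hmax : ∀ l, IsCycleList G l → l.length ≤ 4) (hz : z ∉ [v₀, v₁, v₂, v₃])
    (hw : w ∉ [v₀, v₁, v₂, v₃]) (hwz : w ≠ z) (hz₀ : G.Adj z v₀) (hz₂ : G.Adj z v₂) {a b : V}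
    (ha : a ∈ [v₀, v₁, v₂, v₃]) (hb : b ∈ [v₀, v₁, v₂, v₃]) (hab : a ≠ b)
    (hwa : G.Adj w a) (hwb : G.Adj w b) (hm : Fintype.card V ≤ m + 3) :
    HasRainbow G Set.univ m := by
  obtain ⟨hn, hc, hl⟩ := h
  have hcl : G.Adj v₃ v₀ := hl _ (by simp) _ (by simp)
  simp only [List.isChain_cons_cons, List.isChain_singleton, and_true] at hc
  obtain ⟨h01, h12, h23⟩ := hc
  simp only [List.nodup_cons, List.mem_cons, List.not_mem_nil, or_false, not_or, not_false_eq_true,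
    List.nodup_nil, and_true] at hn hz hw
  have ex : ∀ c₀ c₁ c₂ c₃ c₄ : V, [c₀, c₁, c₂, c₃, c₄].Nodup → G.Adj c₀ c₁ → G.Adj c₁ c₂ →
      G.Adj c₂ c₃ → G.Adj c₃ c₄ → G.Adj c₄ c₀ → False := by
    intro c₀ c₁ c₂ c₃ c₄ hn h0 h1 h2 h3 h4
    have := hmax [c₀, c₁, c₂, c₃, c₄] ⟨hn, by simp [*], by simp [*]⟩
    simp at this
  have A01 : G.Adj w v₀ → G.Adj w v₁ → False := fun e e' =>
    ex v₁ v₂ v₃ v₀ w (by simp; grind) h12 h23 hcl e.symm e'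
  have A12 : G.Adj w v₁ → G.Adj w v₂ → False := fun e e' =>
    ex v₂ v₃ v₀ v₁ w (by simp; grind) h23 hcl h01 e.symm e'
  have A23 : G.Adj w v₂ → G.Adj w v₃ → False := fun e e' =>
    ex v₃ v₀ v₁ v₂ w (by simp; grind) hcl h01 h12 e.symm e'
  have A30 : G.Adj w v₃ → G.Adj w v₀ → False := fun e e' =>
    ex v₀ v₁ v₂ v₃ w (by simp; grind) h01 h12 h23 e.symm e'
  have A13 : G.Adj w v₁ → G.Adj w v₃ → False := fun e e' => by
    have := hmax [w, v₁, v₀, z, v₂, v₃] ⟨by simp; grind,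
      by simp [e, h01.symm, hz₀.symm, hz₂, h23], by simp [e'.symm]⟩
    simp at this
  have B02 : G.Adj w v₀ → G.Adj w v₂ → HasRainbow G Set.univ m := fun e e' =>
    hasRainbow_of_bipartite hG (h := v₀) (h' := v₂) (p := v₁) (q := v₃) (r := z) (s := w)
      (by simp; grind) ⟨h01, h12.symm⟩ ⟨hcl.symm, h23⟩ ⟨hz₀.symm, hz₂.symm⟩
      ⟨e.symm, e'.symm⟩ hm
  simp only [List.mem_cons, List.not_mem_nil, or_false] at ha hb
  rcases ha with rfl | rfl | rfl | rfl <;> rcases hb with rfl | rfl | rfl | rfl <;>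
    first
    | exact absurd rfl hab
    | exact B02 hwa hwb
    | exact B02 hwb hwa
    | exact (A01 hwa hwb).elim
    | exact (A01 hwb hwa).elim
    | exact (A12 hwa hwb).elim
    | exact (A12 hwb hwa).elim
    | exact (A23 hwa hwb).elim
    | exact (A23 hwb hwa).elim
    | exact (A30 hwa hwb).elim
    | exact (A30 hwb hwa).elim
    | exact (A13 hwa hwb).elim
    | exact (A13 hwb hwa).elim

/-- An edge, as a degenerate cycle of length two, starts the search; `four_le_length` later excludes
that a short cycle is longest without spanning. -/
theorem IsBiconnected.exists_longest [Fintype V] (hG : G.IsBiconnected)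
    (h2 : 2 ≤ Fintype.card V) : ∃ l, IsCycleList G l ∧ 2 ≤ l.length ∧
      ∀ l', IsCycleList G l' → l'.length ≤ l.length := by
  have : Nontrivial V := Fintype.one_lt_card_iff_nontrivial.1 h2
  obtain ⟨a⟩ := hG.1.nonempty
  obtain ⟨b, hab⟩ := hG.1.preconnected.exists_adj_of_nontrivial a
  exact exists_maximal_isCycleList (l := [a, b]) ⟨by simpa using hab.ne, by simpa using hab,
    by simpa using hab.symm⟩

theorem exists_notMem_of_length_lt [Fintype V] {l : List V} (h : l.length < Fintype.card V) :
    ∃ z, z ∉ l := by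
  classical
  by_contra! hall
  have : (Finset.univ : Finset V) ⊆ l.toFinset := fun v _ => List.mem_toFinset.2 (hall v)
  have := (Finset.card_le_card this).trans (List.toFinset_card_le l)
  rw [Finset.card_univ] at this
  omega

/-- A biconnected graph of order at least four needs at most `n - 2` colors. -/
theorem IsBiconnected.hasRainbow_two [Fintype V] (hG : G.IsBiconnected) {m : ℕ}
    (h4 : 4 ≤ Fintype.card V) (hm : Fintype.card V ≤ m + 2) : HasRainbow G Set.univ m := by
  obtain ⟨l, hl, h2, hmax⟩ := hG.exists_longest (by omega)
  refine hl.hasRainbow_four hG.1 ?_ hm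
  by_cases hlt : l.length < Fintype.card V
  · obtain ⟨z, hz⟩ := exists_notMem_of_length_lt hlt
    exact hG.four_le_length hl h2 hmax hz
  · omega

/-- A spanning cycle without chords is the whole graph. -/
theorem IsCycleList.exists_chord [Fintype V] {l : List V} (hl : IsCycleList G l)
    (hlen : l.length = Fintype.card V) (h3 : 3 ≤ l.length)
    (hcyc : ¬ Nonempty (G ≃g cycleGraph (Fintype.card V))) :
    ∃ (i j : ℕ) (hi : i < l.length) (hj : j < l.length), i + 2 ≤ j ∧ (i ≠ 0 ∨ j + 1 ≠ l.length) ∧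
      G.Adj l[i] l[j] := by
  by_contra! hno
  apply hcyc
  rw [← hlen]
  have hbij : Function.Bijective (fun i : Fin l.length => l[i]) :=
    (Fintype.bijective_iff_injective_and_card _).2
      ⟨fun i j h => Fin.ext (hl.1.getElem_inj_iff.1 h), by simpa using hlen⟩
  have hlt : ∀ i j (hi : i < l.length) (hj : j < l.length), i < j →
      (G.Adj l[i] l[j] ↔ j = i + 1 ∨ (i = 0 ∧ j + 1 = l.length)) := by
    intro i j hi hj hij
    constructor
    · intro h
      by_contra! hc
      refine hno i j hi hj (by omega) ?_ h
      by_contra! h'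
      exact hc.2 h'.1 h'.2
    · rintro (rfl | ⟨rfl, h⟩)
      · exact hl.getElem_adj hj
      · obtain rfl : j = l.length - 1 := by omega
        exact (hl.closing_adj (by omega)).symm
  refine ⟨(RelIso.mk (Equiv.ofBijective _ hbij) ?_ : cycleGraph l.length ≃g G).symm⟩
  rintro ⟨i, hi⟩ ⟨j, hj⟩
  change G.Adj l[i] l[j] ↔ _
  rw [cycleGraph_adj']
  rcases lt_trichotomy i j with h | rfl | h
  · rw [hlt i j hi hj h]
    have e1 : (l.length - i + j) % l.length = j - i := by
      rw [show l.length - i + j = (j - i) + l.length by omega, Nat.add_mod_right,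
        Nat.mod_eq_of_lt (by omega)]
    have e2 : (l.length - j + i) % l.length = l.length - (j - i) := by
      rw [show l.length - j + i = l.length - (j - i) by omega, Nat.mod_eq_of_lt (by omega)]
    simp only [Fin.sub_def, e1, e2]
    omega
  · simp only [Fin.sub_def, Nat.sub_add_cancel hi.le, Nat.mod_self]
    simp
  · rw [adj_comm, hlt j i hj hi h]
    have e1 : (l.length - j + i) % l.length = i - j := by
      rw [show l.length - j + i = (i - j) + l.length by omega, Nat.add_mod_right,
        Nat.mod_eq_of_lt (by omega)]
    have e2 : (l.length - i + j) % l.length = l.length - (i - j) := by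
      rw [show l.length - i + j = l.length - (i - j) by omega, Nat.mod_eq_of_lt (by omega)]
    simp only [Fin.sub_def, e1, e2]
    omega

/-- A biconnected graph of order at least seven that is not a cycle needs at most `n - 3`
colors. -/
theorem IsBiconnected.hasRainbow_three [Fintype V] (hG : G.IsBiconnected) {m : ℕ}
    (h7 : 7 ≤ Fintype.card V) (hcyc : ¬ Nonempty (G ≃g cycleGraph (Fintype.card V)))
    (hm : Fintype.card V ≤ m + 3) : HasRainbow G Set.univ m := by
  obtain ⟨l, hl, h2, hmax⟩ := hG.exists_longest (by omega)
  by_cases hlt : l.length < Fintype.card V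
  · obtain ⟨z, hz⟩ := exists_notMem_of_length_lt hlt
    have h4 := hG.four_le_length hl h2 hmax hz
    by_cases h6 : 6 ≤ l.length
    · obtain ⟨c, hc, c', hc', hcc⟩ := exists_pair_mem_of_two_le hl.1 h2
      obtain ⟨x, y, a, b, ha, hb, hab, hx, hy, hax, hyb⟩ :=
        hG.exists_ear (C := {v | v ∈ l}) hz hc hc' hcc
      have hxC := notMem_of_offGraph_reachable (C := {v | v ∈ l}) hz hx
      obtain ⟨q, hq, hqc, hqx, hqy, hqd⟩ := exists_path_list hxC (hx.symm.trans hy)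
      obtain ⟨l', hl', hlen, hmem⟩ := hl.exists_cons ha
      obtain ⟨j, hj, rfl⟩ := List.getElem_of_mem ((hmem b).2 hb)
      refine hl'.hasRainbow_apex hG.1 (by omega) (j := j) ?_ hj hq hqc
        (fun v hv hv' => hqd v hv ((hmem v).1 hv')) hqx hqy hax hyb hm
      rcases j with _ | j
      · exact absurd rfl hab
      · omega
    -- At most five vertices lie on the cycle and the order is at least seven, so a second vertex is
    -- missed.
    · obtain ⟨w, hw⟩ := exists_notMem_of_length_lt (l := z :: l) (by simp; omega)
      simp only [List.mem_cons, not_or] at hw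
      obtain ⟨a, ha, b, hb, hab, hza, hzb⟩ :=
        hG.exists_two_neighbors hl h2 (by omega) hmax hz
      obtain ⟨c, hc, d, hd, hcd, hwc, hwd⟩ :=
        hG.exists_two_neighbors hl h2 (by omega) hmax hw.2
      obtain ⟨l', hl', hlen, hmem⟩ := hl.exists_cons ha
      simp only [← hmem] at hz hw hb hc hd
      rw [← hlen] at hmax h4 h6
      clear hmem hlen ha hlt hl h2
      match l', h4, h6 with
      | [v₁, v₂, v₃], _, _ =>
        have hmax : ∀ l, IsCycleList G l → l.length ≤ 4 := hmax
        have hn := hl'.1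
        have hch := hl'.2.1
        have hcl : G.Adj v₃ a := hl'.2.2 _ (by simp) _ (by simp)
        simp only [List.isChain_cons_cons, List.isChain_singleton, and_true] at hch
        have hz' := hz
        simp only [List.nodup_cons, List.mem_cons, List.not_mem_nil, or_false, not_or,
          not_false_eq_true, List.nodup_nil, and_true] at hn hz'
        simp only [List.mem_cons, List.not_mem_nil, or_false] at hb
        rcases hb with rfl | rfl | rfl | rfl
        · exact absurd rfl hab
        · have := hmax [b, v₂, v₃, a, z] ⟨by simp; grind,
            by simp [hch, hcl, hza.symm], by simp [hzb]⟩
          simp at this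
        · exact hasRainbow_of_four_cycle hG.1 hl' hmax hz hw.2 hw.1 hza hzb hc hd hcd hwc hwd hm
        · have := hmax [a, v₁, v₂, b, z] ⟨by simp; grind,
            by simp [hch, hzb.symm], by simp [hza]⟩
          simp at this
      | [v₁, v₂, v₃, v₄], _, _ =>
        have hmax : ∀ l, IsCycleList G l → l.length ≤ 5 := hmax
        have hn := hl'.1
        have hch := hl'.2.1
        have hcl : G.Adj v₄ a := hl'.2.2 _ (by simp) _ (by simp)
        simp only [List.isChain_cons_cons, List.isChain_singleton, and_true] at hch
        have hz' := hz
        simp only [List.nodup_cons, List.mem_cons, List.not_mem_nil, or_false, not_or,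
          not_false_eq_true, List.nodup_nil, and_true] at hn hz'
        simp only [List.mem_cons, List.not_mem_nil, or_false] at hb
        rcases hb with rfl | rfl | rfl | rfl | rfl
        · exact absurd rfl hab
        -- If `a` and `b` are consecutive, `z` can be inserted between them.
        · have := hmax [b, v₂, v₃, v₄, a, z] ⟨by simp; grind,
            by simp [hch, hcl, hza.symm], by simp [hzb]⟩
          simp at this
        · exact hasRainbow_of_five_cycle hG.1 hl' hmax hz hw.2 hw.1 hza hzb hc hd hcd hwc hwd hm
        -- Here `a` and `b` are at distance two the other way round, so the cycle is read from `b`.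
        · have hrot : IsCycleList G [b, v₄, a, v₁, v₂] :=
            IsCycleList.rotate (l := [a, v₁, v₂]) (q := [b, v₄]) hl'
          have hmem : ∀ v, v ∈ [a, v₁, v₂, b, v₄] ↔ v ∈ [b, v₄, a, v₁, v₂] := fun v => by
            simp only [List.mem_cons, List.not_mem_nil, or_false]
            tauto
          rw [hmem] at hz hw hc hd
          exact hasRainbow_of_five_cycle hG.1 hrot hmax hz hw.2 hw.1 hzb hza hc hd hcd hwc hwd hm
        · have := hmax [a, v₁, v₂, v₃, b, z] ⟨by simp; grind,
            by simp [hch, hzb.symm], by simp [hza]⟩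
          simp at this
      | [], h, _ => simp at h
      | [_], h, _ => simp at h
      | [_, _], h, _ => simp at h
      | _ :: _ :: _ :: _ :: _ :: _, _, h => simp at h
  · have hlen : l.length = Fintype.card V := le_antisymm hl.1.length_le_card (by omega)
    obtain ⟨i, j, hi, hj, hij, hne, hadj⟩ := hl.exists_chord hlen (by omega) hcyc
    have hr : IsCycleList G (l.drop i ++ l.take i) :=
      IsCycleList.rotate (by rwa [List.take_append_drop])
    have hrl : (l.drop i ++ l.take i).length = l.length := by simp; omega
    refine hr.hasRainbow_chord hG.1 (by omega) (j := j - i) (by omega) (by omega) ?_ hm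
    rw [List.getElem_append_left (by simp; omega), List.getElem_append_left (by simp; omega),
      List.getElem_drop, List.getElem_drop]
    simpa only [Nat.add_zero, Nat.add_sub_cancel' (show i ≤ j by omega)] using hadj

end Biconnected

/-! ### Splitting at cut vertices and summing over blocks -/

section Blocks

variable {V : Type*} {G : SimpleGraph V}

theorem Subgraph.IsNonseparable.isBiconnected_coe {X : G.Subgraph} (hX : X.IsNonseparable) :
    X.coe.IsBiconnected := by
  refine ⟨hX.1, fun v x y hx hy => ?_⟩
  have hne : ∀ w : X.verts, w ≠ v → (w : V) ∈ (X.deleteVerts {↑v}).verts := fun w hw =>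
    ⟨w.2, fun h => hw (Subtype.ext h)⟩
  have h := hX.2 v v.2 ⟨x, hne x hx⟩ ⟨y, hne y hy⟩
  let φ : (X.deleteVerts {↑v}).coe →g offGraph X.coe {v} :=
    { toFun := fun w => ⟨w, w.2.1⟩
      map_rel' := by
        intro a b hab
        rw [Subgraph.coe_adj, Subgraph.deleteVerts_adj] at hab
        obtain ⟨-, h2, -, h4, h5⟩ := hab
        exact ⟨h5, fun h => h2 (congrArg Subtype.val h), fun h => h4 (congrArg Subtype.val h)⟩ }
  exact h.map φ

theorem HasRainbow.spanningCoe {X : G.Subgraph} {m : ℕ} (h : HasRainbow X.coe Set.univ m) :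
    HasRainbow X.spanningCoe X.verts m := by
  obtain ⟨c, hc⟩ := h
  have hinj : Function.Injective (Sym2.map (Subtype.val : X.verts → V)) :=
    Sym2.map.injective Subtype.val_injective
  refine ⟨Function.extend (Sym2.map Subtype.val) c 0, fun x hx y hy z hz => ?_⟩
  obtain ⟨H, h1, h2, h3, h4, h5⟩ := hc ⟨x, hx⟩ trivial ⟨y, hy⟩ trivial ⟨z, hz⟩ trivial
  have hE : (H.map (Function.Embedding.subtype _)).edgeSet = Sym2.map Subtype.val '' H.edgeSet :=
    edgeSet_map _ _
  refine ⟨H.map (Function.Embedding.subtype _), ?_, ?_, ?_,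
    h4.map (Embedding.map (Function.Embedding.subtype _) H).toHom,
    h5.map (Embedding.map (Function.Embedding.subtype _) H).toHom⟩
  · rw [map_le_iff_le_comap]
    exact h1
  · rw [hE]
    rintro _ ⟨e, he, rfl⟩ _ ⟨e', he', rfl⟩ h
    rw [hinj.extend_apply, hinj.extend_apply] at h
    rw [h2 he he' h]
  · rw [hE]
    rintro _ ⟨e, he, rfl⟩
    rw [hinj.extend_apply]
    exact h3 e he

/-- A part of a connected subgraph that can only be left through `v` is connected. -/
theorem Subgraph.Connected.induce_of_closed {H : G.Subgraph} (hH : H.Connected) {U : Set V} {v : V}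
    (hUH : U ⊆ H.verts) (hv : v ∈ U) (hU : ∀ x ∈ U, x ≠ v → ∀ y, H.Adj x y → y ∈ U) :
    (H.induce U).Connected := by
  have key : ∀ (x y : H.verts), H.coe.Walk x y → (y : V) = v → ∀ hx : (x : V) ∈ U,
      (H.induce U).coe.Reachable ⟨x, hx⟩ ⟨v, hv⟩ := by
    intro x y p
    induction p with
    | nil => rintro rfl hx; rfl
    | @cons a b c h p ih =>
      intro hc ha
      by_cases hav : (a : V) = v
      · have : (⟨a, ha⟩ : (H.induce U).verts) = ⟨v, hv⟩ := Subtype.ext hav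
        rw [this]
      · have hb := hU a ha hav b h
        refine (Adj.reachable ?_).trans (ih hc hb)
        exact ⟨ha, hb, h⟩
  rw [Subgraph.connected_iff']
  have : Nonempty (H.induce U).verts := ⟨⟨v, hv⟩⟩
  refine ⟨fun x y => ?_⟩
  obtain ⟨p⟩ := hH.preconnected ⟨x, hUH x.2⟩ ⟨v, hUH hv⟩
  obtain ⟨q⟩ := hH.preconnected ⟨y, hUH y.2⟩ ⟨v, hUH hv⟩
  exact (key _ _ p rfl x.2).trans (key _ _ q rfl y.2).symm

/-- A connected subgraph with a cut vertex splits there into two smaller connected subgraphs. -/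
theorem Subgraph.Connected.exists_split {H : G.Subgraph} (hH : H.Connected)
    (hn : ¬ H.IsNonseparable) : ∃ (v : V) (H₁ H₂ : G.Subgraph), H₁.Connected ∧ H₂.Connected ∧
      H = H₁ ⊔ H₂ ∧ H₁.verts ∩ H₂.verts = {v} ∧ H₁.verts ⊂ H.verts ∧ H₂.verts ⊂ H.verts := by
  simp only [Subgraph.IsNonseparable, hH, true_and, not_forall] at hn
  obtain ⟨v, hv, hn⟩ := hn
  rw [Subgraph.preconnected_iff] at hn
  obtain ⟨a, b, hab⟩ : ∃ a b, ¬ (H.deleteVerts {v}).coe.Reachable a b := by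
    by_contra! h
    exact hn h
  -- `R` is the component of `a` after deletion of `v`. The two pieces are induced on `R` with `v`,
  -- and on the complement of `R`, which contains `v` and `b`.
  let R : Set V := {x | ∃ hx : x ∈ (H.deleteVerts {v}).verts,
    (H.deleteVerts {v}).coe.Reachable a ⟨x, hx⟩}
  have hvR : v ∉ R := fun ⟨h, _⟩ => h.2 rfl
  have hRH : R ⊆ H.verts := fun x ⟨h, _⟩ => h.1
  have hR : ∀ x ∈ R, ∀ y, H.Adj x y → y ≠ v → y ∈ R := by
    rintro x ⟨hx, hr⟩ y hxy hy
    have hy' : y ∈ (H.deleteVerts {v}).verts := ⟨H.edge_vert hxy.symm, hy⟩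
    refine ⟨hy', hr.trans (Adj.reachable ?_)⟩
    rw [Subgraph.coe_adj, Subgraph.deleteVerts_adj]
    exact ⟨hx.1, hx.2, hy'.1, hy'.2, hxy⟩
  have hc1 : ∀ x ∈ insert v R, x ≠ v → ∀ y, H.Adj x y → y ∈ insert v R := by
    intro x hx hxv y hxy
    by_cases hy : y = v
    · exact Or.inl hy
    · exact Or.inr (hR x (hx.resolve_left hxv) y hxy hy)
  have hc2 : ∀ x ∈ H.verts \ R, x ≠ v → ∀ y, H.Adj x y → y ∈ H.verts \ R := by
    intro x hx hxv y hxy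
    exact ⟨H.edge_vert hxy.symm, fun hy => hx.2 (hR y hy x hxy.symm hxv)⟩
  have hU1 : insert v R ⊆ H.verts := Set.insert_subset hv hRH
  refine ⟨v, H.induce (insert v R), H.induce (H.verts \ R),
    hH.induce_of_closed hU1 (Or.inl rfl) hc1,
    hH.induce_of_closed Set.sdiff_subset ⟨hv, hvR⟩ hc2, ?_, ?_, ?_, ?_⟩
  · apply Subgraph.ext
    · ext x
      simp only [Subgraph.verts_sup, Subgraph.induce_verts, Set.mem_union, Set.mem_insert_iff,
        Set.mem_sdiff]
      constructor
      · intro h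
        by_cases hx : x ∈ R
        · exact Or.inl (Or.inr hx)
        · exact Or.inr ⟨h, hx⟩
      · rintro ((rfl | h) | h)
        · exact hv
        · exact hRH h
        · exact h.1
    · ext x y
      simp only [Subgraph.sup_adj, Subgraph.induce_adj]
      constructor
      · intro h
        have hxH := H.edge_vert h
        have hyH := H.edge_vert h.symm
        by_cases hx : x ∈ R
        · exact Or.inl ⟨Or.inr hx, hc1 x (Or.inr hx) (fun h => hvR (h ▸ hx)) y h, h⟩
        · by_cases hy : y ∈ R
          · exact Or.inl ⟨hc1 y (Or.inr hy) (fun h => hvR (h ▸ hy)) x h.symm, Or.inr hy, h⟩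
          · exact Or.inr ⟨⟨hxH, hx⟩, ⟨hyH, hy⟩, h⟩
      · rintro (h | h)
        · exact h.2.2
        · exact h.2.2
  · ext x
    simp only [Subgraph.induce_verts, Set.mem_inter_iff, Set.mem_insert_iff, Set.mem_sdiff,
      Set.mem_singleton_iff]
    constructor
    · rintro ⟨rfl | h, -, h'⟩
      · rfl
      · exact absurd h h'
    · rintro rfl
      exact ⟨Or.inl rfl, hv, hvR⟩
  · refine ⟨hU1, fun h => ?_⟩
    rcases h b.2.1 with h | ⟨_, h⟩
    · exact b.2.2 h
    · exact hab h
  · exact ⟨Set.sdiff_subset, fun h => (h a.2.1).2 ⟨a.2, Reachable.refl _⟩⟩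

theorem Subgraph.IsNonseparable.preconnected_deleteVerts {X : G.Subgraph} (hX : X.IsNonseparable)
    (v : V) : (X.deleteVerts {v}).Preconnected := by
  by_cases hv : v ∈ X.verts
  · exact hX.2 v hv
  · have : X.deleteVerts {v} = X := by
      rw [← Subgraph.deleteVerts_inter_verts_left_eq, Set.inter_singleton_eq_empty.2 hv,
        Subgraph.deleteVerts_empty]
    rw [this]
    exact hX.1.preconnected

/-- An edge of `H₂` with both ends in `H₁` would have both ends equal to `v`. -/
theorem Subgraph.IsNonseparable.le_of_subset {X H₁ H₂ : G.Subgraph} {v : V} (hle : X ≤ H₁ ⊔ H₂)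
    (hv : H₁.verts ∩ H₂.verts = {v}) (h : X.verts ⊆ H₁.verts) : X ≤ H₁ := by
  refine ⟨h, fun p q hpq => ?_⟩
  rcases hle.2 hpq with h' | h'
  · exact h'
  · have hp : p ∈ H₁.verts ∩ H₂.verts := ⟨h (X.edge_vert hpq), H₂.edge_vert h'⟩
    have hq : q ∈ H₁.verts ∩ H₂.verts := ⟨h (X.edge_vert hpq.symm), H₂.edge_vert h'.symm⟩
    rw [hv] at hp hq
    exact absurd (hp.trans hq.symm) hpq.ne

/-- A nonseparable subgraph lies on one side of a cut vertex. -/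
theorem Subgraph.IsNonseparable.le_or_le {X H₁ H₂ : G.Subgraph} (hX : X.IsNonseparable) {v : V}
    (hle : X ≤ H₁ ⊔ H₂) (hv : H₁.verts ∩ H₂.verts = {v}) : X ≤ H₁ ∨ X ≤ H₂ := by
  by_cases h1 : X.verts ⊆ H₁.verts
  · exact Or.inl (IsNonseparable.le_of_subset hle hv h1)
  by_cases h2 : X.verts ⊆ H₂.verts
  · rw [sup_comm] at hle
    rw [Set.inter_comm] at hv
    exact Or.inr (IsNonseparable.le_of_subset hle hv h2)
  exfalso
  obtain ⟨b, hb, hb1⟩ := Set.not_subset.1 h1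
  obtain ⟨a, ha, ha2⟩ := Set.not_subset.1 h2
  have hvv : v ∈ H₁.verts ∩ H₂.verts := hv ▸ rfl
  have ha' : a ∈ (X.deleteVerts {v}).verts := ⟨ha, fun h => ha2 ((show a = v from h) ▸ hvv.2)⟩
  have hb' : b ∈ (X.deleteVerts {v}).verts := ⟨hb, fun h => hb1 ((show b = v from h) ▸ hvv.1)⟩
  -- A walk in `X - v` from `a` to `b` has an edge leaving `H₁`. It is not in `H₁`, and in `H₂` its
  -- first end would be common to both, hence `v`.
  obtain ⟨p⟩ := hX.preconnected_deleteVerts v ⟨a, ha'⟩ ⟨b, hb'⟩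
  obtain ⟨⟨⟨x, y⟩, hxy⟩, -, hx, hy⟩ := p.exists_boundary_dart {w | (w : V) ∈ H₁.verts}
    ((hle.1 ha).resolve_right ha2) hb1
  simp only [Set.mem_ofPred_eq] at hx hy
  rw [Subgraph.coe_adj, Subgraph.deleteVerts_adj] at hxy
  obtain ⟨-, hxv, -, -, hxy⟩ := hxy
  rcases hle.2 hxy with h | h
  · exact hy (H₁.edge_vert h.symm)
  · have : (x : V) ∈ H₁.verts ∩ H₂.verts := ⟨hx, H₂.edge_vert h⟩
    rw [hv] at this
    exact hxv this

/-- The blocks of a subgraph. -/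
def blocksIn (H : G.Subgraph) : Set G.Subgraph :=
  {X | Maximal (fun Y => Y ≤ H ∧ Y.IsNonseparable) X}

/-- An inclusion is enough: the induction only needs the whole to have no more blocks than the
pieces together. -/
theorem blocksIn_sup_subset {H₁ H₂ : G.Subgraph} {v : V} (hv : H₁.verts ∩ H₂.verts = {v}) :
    blocksIn (H₁ ⊔ H₂) ⊆ blocksIn H₁ ∪ blocksIn H₂ := by
  intro X hX
  rcases hX.1.2.le_or_le hX.1.1 hv with h | h
  · exact Or.inl ⟨⟨h, hX.1.2⟩, fun Y hY hXY => hX.2 ⟨hY.1.trans le_sup_left, hY.2⟩ hXY⟩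
  · exact Or.inr ⟨⟨h, hX.1.2⟩, fun Y hY hXY => hX.2 ⟨hY.1.trans le_sup_right, hY.2⟩ hXY⟩

theorem Subgraph.IsNonseparable.blocksIn_eq {H : G.Subgraph} (hH : H.IsNonseparable) :
    blocksIn H ⊆ {H} := fun _ hX =>
  le_antisymm hX.1.1 (hX.2 ⟨le_rfl, hH⟩ hX.1.1)

/-- Strong induction on the order. A nonseparable `H` is its own only possible block and saves zero,
one or two colors beyond a spanning tree; otherwise `H` splits at a cut vertex and the savings add.
-/
theorem Subgraph.Connected.exists_hasRainbow [Fintype V] {C D : G.Subgraph → Prop}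
    (hC : ∀ X, C X → 4 ≤ X.verts.ncard)
    (hD : ∀ X, D X → 7 ≤ X.verts.ncard ∧ ¬ X.IsCycleGraph ∧ ¬ C X) {H : G.Subgraph}
    (hH : H.Connected) : ∃ m, m + ({X | X ∈ blocksIn H ∧ C X}.ncard +
      2 * {X | X ∈ blocksIn H ∧ D X}.ncard + 1) ≤ H.verts.ncard ∧
      HasRainbow H.spanningCoe H.verts m := by
  classical
  induction hk : H.verts.ncard using Nat.strong_induction_on generalizing H with
  | _ n ih =>
  by_cases hn : H.IsNonseparable
  · have hb := hn.isBiconnected_coe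
    have hsub : ∀ P : G.Subgraph → Prop, {X | X ∈ blocksIn H ∧ P X}.ncard ≤ 1 ∧
        (¬ P H → {X | X ∈ blocksIn H ∧ P X}.ncard = 0) := by
      intro P
      constructor
      · rw [← Set.ncard_singleton H]
        exact Set.ncard_le_ncard (fun X hX => hn.blocksIn_eq hX.1) (Set.finite_singleton H)
      · intro hP
        rw [Set.ncard_eq_zero (Set.toFinite _), Set.eq_empty_iff_forall_notMem]
        rintro X ⟨hX, hPX⟩
        obtain rfl : X = H := hn.blocksIn_eq hX
        exact hP hPX
    have hcard : Fintype.card H.verts = n := by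
      rw [← hk, ← Nat.card_coe_set_eq, Nat.card_eq_fintype_card]
    have h0 : 0 < n := by
      rw [← hcard]
      have := hb.1.nonempty
      exact Fintype.card_pos
    by_cases hDH : D H
    · obtain ⟨h7, hcyc, hCH⟩ := hD H hDH
      refine ⟨n - 3, ?_, (hb.hasRainbow_three (by omega) ?_ (by omega)).spanningCoe⟩
      · have := (hsub D).1
        have := (hsub C).2 hCH
        omega
      · exact fun h => hcyc ⟨_, by omega, h⟩
    · have hD0 := (hsub D).2 hDH
      by_cases hCH : C H
      · have h4 := hC H hCH
        refine ⟨n - 2, ?_, (hb.hasRainbow_two (by omega) (by omega)).spanningCoe⟩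
        have := (hsub C).1
        omega
      · refine ⟨n - 1, ?_, (hb.1.hasRainbow (by omega)).spanningCoe⟩
        have := (hsub C).2 hCH
        omega
  · obtain ⟨v, H₁, H₂, hc1, hc2, rfl, hv, hl1, hl2⟩ := hH.exists_split hn
    obtain ⟨m₁, hm₁, hr₁⟩ := ih _ (hk ▸ Set.ncard_lt_ncard hl1) hc1 rfl
    obtain ⟨m₂, hm₂, hr₂⟩ := ih _ (hk ▸ Set.ncard_lt_ncard hl2) hc2 rfl
    have hvv : v ∈ H₁.verts ∩ H₂.verts := hv ▸ rfl
    have hadd : ∀ P : G.Subgraph → Prop, {X | X ∈ blocksIn (H₁ ⊔ H₂) ∧ P X}.ncard ≤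
        {X | X ∈ blocksIn H₁ ∧ P X}.ncard + {X | X ∈ blocksIn H₂ ∧ P X}.ncard := by
      intro P
      refine (Set.ncard_le_ncard ?_ (Set.toFinite _)).trans (Set.ncard_union_le _ _)
      rintro X ⟨hX, hP⟩
      rcases blocksIn_sup_subset hv hX with h | h
      · exact Or.inl ⟨h, hP⟩
      · exact Or.inr ⟨h, hP⟩
    -- The cut vertex is counted twice, which makes up for the second `+ 1` when the two bounds are
    -- added.
    have hu := Set.ncard_union_add_ncard_inter H₁.verts H₂.verts
    rw [hv, Set.ncard_singleton, ← Subgraph.verts_sup, hk] at hu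
    refine ⟨m₁ + m₂, ?_, ?_⟩
    · have := hadd C
      have := hadd D
      omega
    · have hd : Disjoint H₁.spanningCoe.edgeSet H₂.spanningCoe.edgeSet := by
        rw [Set.disjoint_left]
        intro e h1 h2
        induction e with | _ p q =>
        have h1 : H₁.Adj p q := h1
        have h2 : H₂.Adj p q := h2
        have hp : p ∈ H₁.verts ∩ H₂.verts := ⟨H₁.edge_vert h1, H₂.edge_vert h2⟩
        have hq : q ∈ H₁.verts ∩ H₂.verts := ⟨H₁.edge_vert h1.symm, H₂.edge_vert h2.symm⟩
        rw [hv] at hp hq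
        exact h1.ne (hp.trans hq.symm)
      exact (hr₁.sup hr₂ hd hvv.1 hvv.2).mono (sup_le (Subgraph.spanningCoe_le_of_le le_sup_left)
        (Subgraph.spanningCoe_le_of_le le_sup_right)) subset_rfl le_rfl

/-- The upper bound on the `3`-rainbow index in terms of the blocks. -/
theorem Connected.rainbowIndex_three_add_le [Fintype V] (hG : G.Connected) :
    G.rainbowIndex 3 + (G.blocksC.ncard + 2 * G.blocksD.ncard + 1 : ℕ) ≤
      (Fintype.card V : ℕ∞) := by
  have hT : (⊤ : G.Subgraph).Connected := by
    rw [Subgraph.connected_iff']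
    exact (Subgraph.topIso (G := G)).connected_iff.2 hG
  obtain ⟨m, hm, hr⟩ := hT.exists_hasRainbow
    (C := fun X => (X.IsCycleGraph ∧ 4 ≤ X.verts.ncard) ∨
      (4 ≤ X.verts.ncard ∧ X.verts.ncard ≤ 6))
    (D := fun X => ¬ X.IsCycleGraph ∧ 7 ≤ X.verts.ncard)
    (by
      rintro X (h | h)
      · exact h.2
      · exact h.1)
    (by
      rintro X ⟨h1, h2⟩
      refine ⟨h2, h1, ?_⟩
      rintro (h | h)
      · exact h1 h.1
      · omega)
  have hb : ∀ X, X ∈ blocksIn (⊤ : G.Subgraph) ↔ X.IsBlock := fun X => by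
    simp only [blocksIn, Subgraph.IsBlock, le_top, true_and]
    rfl
  simp only [hb] at hm
  rw [Subgraph.spanningCoe_top, Subgraph.verts_top] at hr
  rw [Subgraph.verts_top, Set.ncard_univ, Nat.card_eq_fintype_card] at hm
  calc G.rainbowIndex 3 + (G.blocksC.ncard + 2 * G.blocksD.ncard + 1 : ℕ)
      ≤ (m : ℕ∞) + (G.blocksC.ncard + 2 * G.blocksD.ncard + 1 : ℕ) :=
        add_le_add_left hr.rainbowIndex_le _
    _ ≤ _ := by exact_mod_cast hm

end Blocks

/-! ### The chain of blocks that attains the bound -/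

section Extremal

/-- Adjacency `i < j` in a cycle of length seven on `0, …, 6` with the chord from `0` to `2`,
followed by `r` cycles of length four and a path. -/
def ChainRel (r i j : ℕ) : Prop :=
  (j ≤ 6 ∧ (j = i + 1 ∨ (i = 0 ∧ (j = 6 ∨ j = 2)))) ∨
  (6 ≤ i ∧ j ≤ 3 * r + 6 ∧ ((i % 3 = 0 ∧ (j = i + 1 ∨ j = i + 2)) ∨ (i % 3 = 1 ∧ j = i + 2) ∨
    (i % 3 = 2 ∧ j = i + 1))) ∨
  (3 * r + 6 ≤ i ∧ j = i + 1)

theorem ChainRel.lt {r i j : ℕ} (h : ChainRel r i j) : i < j := by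
  unfold ChainRel at h
  omega

/-- A cycle of length seven with a chord, `r` cycles of length four and copies of `K₂`, arranged in
a chain. -/
def chainGraph (r n : ℕ) : SimpleGraph (Fin n) where
  Adj a b := ChainRel r a b ∨ ChainRel r b a
  symm := ⟨fun _ _ h => h.symm⟩
  loopless := ⟨fun _ h => h.elim (fun h => h.lt.ne rfl) fun h => h.lt.ne rfl⟩

theorem chainGraph_connected {r n : ℕ} (hn : 0 < n) : (chainGraph r n).Connected := by
  have key : ∀ k (hk : k < n), (chainGraph r n).Reachable ⟨k, hk⟩ ⟨0, hn⟩ := by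
    intro k
    induction k using Nat.strong_induction_on with
    | _ k ih =>
    intro hk
    by_cases h0 : k = 0
    · subst h0
      rfl
    obtain ⟨i, hi, hik⟩ : ∃ i < k, ChainRel r i k := by
      unfold ChainRel
      by_cases h : 6 < k ∧ k ≤ 3 * r + 6 ∧ k % 3 = 2
      · exact ⟨k - 2, by omega, by omega⟩
      · exact ⟨k - 1, by omega, by omega⟩
    have hadj : (chainGraph r n).Adj ⟨k, hk⟩ ⟨i, by omega⟩ := Or.inr hik
    exact hadj.reachable.trans (ih i hi _)
  have : Nonempty (Fin n) := ⟨⟨0, hn⟩⟩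
  exact ⟨fun x y => (key x x.2).trans (key y y.2).symm⟩

/-- The first vertex of the block with the given index. -/
def chainCut (r k : ℕ) : ℕ := 3 * min k 1 + 3 * min k (r + 1) + (k - (r + 1))

theorem chainCut_strictMono (r : ℕ) : StrictMono (chainCut r) := by
  apply strictMono_nat_of_lt_succ
  intro k
  change chainCut r k < chainCut r (k + 1)
  simp only [chainCut]
  omega

/-- No edge jumps over a cut vertex; all that follows on the blocks rests on this. -/
theorem ChainRel.le_chainCut_or_ge {r i j : ℕ} (h : ChainRel r i j) (k : ℕ) :
    j ≤ chainCut r k ∨ chainCut r k ≤ i := by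
  unfold ChainRel at h
  unfold chainCut
  omega

/-- The blocks of the chain graph. -/
def chainBlock (r n k : ℕ) : (chainGraph r n).Subgraph :=
  (⊤ : (chainGraph r n).Subgraph).induce {v | chainCut r k ≤ v ∧ v ≤ chainCut r (k + 1)}

theorem chainBlock_adj {r n k : ℕ} {a b : Fin n} (ha : a ∈ (chainBlock r n k).verts)
    (hb : b ∈ (chainBlock r n k).verts) :
    (chainBlock r n k).Adj a b ↔ ChainRel r a b ∨ ChainRel r b a :=
  ⟨fun h => h.2.2, fun h => ⟨ha, hb, h⟩⟩

theorem exists_iso_chainBlock {r n k s : ℕ} {Q : SimpleGraph (Fin s)} (σ : Equiv.Perm (Fin s))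
    (hs : chainCut r (k + 1) + 1 = chainCut r k + s) (hn : chainCut r (k + 1) < n)
    (hQ : ∀ i j, Q.Adj i j ↔ ChainRel r (chainCut r k + σ i) (chainCut r k + σ j) ∨
      ChainRel r (chainCut r k + σ j) (chainCut r k + σ i)) :
    Nonempty ((chainBlock r n k).coe ≃g Q) := by
  let f : Fin s → (chainBlock r n k).verts := fun i =>
    ⟨⟨chainCut r k + σ i, by omega⟩, by
      simp only [chainBlock, Subgraph.induce_verts, Set.mem_ofPred_eq]
      omega⟩
  have hf : Function.Bijective f := by
    constructor
    · intro i j h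
      have : chainCut r k + σ i = chainCut r k + σ j :=
        congrArg (fun v : (chainBlock r n k).verts => ((v : Fin n) : ℕ)) h
      exact σ.injective (Fin.ext (by omega))
    · rintro ⟨⟨v, hv⟩, hv1, hv2⟩
      simp only at hv1 hv2
      refine ⟨σ.symm ⟨v - chainCut r k, by omega⟩, ?_⟩
      apply Subtype.ext
      apply Fin.ext
      simp only [f, Equiv.apply_symm_apply]
      omega
  refine ⟨(RelIso.mk (Equiv.ofBijective f hf) ?_ : Q ≃g (chainBlock r n k).coe).symm⟩
  intro i j
  rw [hQ]
  exact chainBlock_adj (f i).2 (f j).2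

theorem cycleGraph_seven_chord_adj : ∀ i j : Fin 7, (cycleGraph 7 ⊔ edge 0 2).Adj i j ↔
    ((j : ℕ) = i + 1 ∨ ((i : ℕ) = 0 ∧ ((j : ℕ) = 6 ∨ (j : ℕ) = 2))) ∨
    ((i : ℕ) = j + 1 ∨ ((j : ℕ) = 0 ∧ ((i : ℕ) = 6 ∨ (i : ℕ) = 2))) := by
  simp only [sup_adj, edge_adj, cycleGraph_adj']
  decide

theorem chainRel_zero_iff {r a b : ℕ} (ha : a < 7) (hb : b < 7) :
    ChainRel r (0 + a) (0 + b) ↔ b = a + 1 ∨ (a = 0 ∧ (b = 6 ∨ b = 2)) := by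
  unfold ChainRel
  constructor
  · rintro (h | h | h) <;> omega
  · intro h
    left
    omega

theorem exists_iso_chainBlock_zero {r n : ℕ} (hn : 3 * r + 7 ≤ n) :
    Nonempty ((chainBlock r n 0).coe ≃g (cycleGraph 7 ⊔ edge 0 2)) := by
  have h0 : chainCut r 0 = 0 := by simp [chainCut]
  have h1 : chainCut r (0 + 1) = 6 := by simp [chainCut]
  refine exists_iso_chainBlock (Equiv.refl _) (by omega) (by omega) fun i j => ?_
  rw [cycleGraph_seven_chord_adj, h0]
  simp only [Equiv.refl_apply]
  rw [chainRel_zero_iff i.2 j.2, chainRel_zero_iff j.2 i.2]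

/-- In the chain, a 4-cycle on `v, …, v + 3` has `v` and `v + 3` opposite, so its cyclic order is
`0, 1, 3, 2`; hence the swap. -/
theorem cycleGraph_four_adj : ∀ i j : Fin 4, (cycleGraph 4).Adj i j ↔
    (fun a b : ℕ => ((a = 0 ∧ (b = 1 ∨ b = 2)) ∨ ((a = 1 ∨ a = 2) ∧ b = 3)) ∨
      ((b = 0 ∧ (a = 1 ∨ a = 2)) ∨ ((b = 1 ∨ b = 2) ∧ a = 3)))
      (Equiv.swap 2 3 i : Fin 4) (Equiv.swap 2 3 j : Fin 4) := by
  simp only [cycleGraph_adj']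
  decide

theorem chainRel_four_iff {r k a b : ℕ} (h1 : 1 ≤ k) (hk : k ≤ r) (ha : a < 4) (hb : b < 4) :
    ChainRel r (3 * k + 3 + a) (3 * k + 3 + b) ↔
      (a = 0 ∧ (b = 1 ∨ b = 2)) ∨ ((a = 1 ∨ a = 2) ∧ b = 3) := by
  unfold ChainRel
  constructor
  · rintro (h | ⟨-, -, h | h | h⟩ | h) <;> omega
  · intro h
    right
    left
    omega

theorem exists_iso_chainBlock_four {r n k : ℕ} (hn : 3 * r + 7 ≤ n) (h1 : 1 ≤ k) (hk : k ≤ r) :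
    Nonempty ((chainBlock r n k).coe ≃g cycleGraph 4) := by
  have e0 : chainCut r k = 3 * k + 3 := by
    unfold chainCut
    omega
  have e1 : chainCut r (k + 1) = 3 * k + 6 := by
    unfold chainCut
    omega
  refine exists_iso_chainBlock (Equiv.swap 2 3) (by omega) (by omega) fun i j => ?_
  rw [cycleGraph_four_adj, e0, chainRel_four_iff h1 hk (Fin.is_lt _) (Fin.is_lt _),
    chainRel_four_iff h1 hk (Fin.is_lt _) (Fin.is_lt _)]

theorem chainRel_two_iff {r k a b : ℕ} (hk : r < k) (ha : a < 2) (hb : b < 2) :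
    ChainRel r (2 * r + 5 + k + a) (2 * r + 5 + k + b) ↔ a = 0 ∧ b = 1 := by
  unfold ChainRel
  constructor
  · rintro (h | h | h) <;> omega
  · intro h
    right
    right
    omega

theorem exists_iso_chainBlock_two {r n k : ℕ} (hn : 2 * r + 6 + k < n) (hk : r < k) :
    Nonempty ((chainBlock r n k).coe ≃g completeGraph (Fin 2)) := by
  have e0 : chainCut r k = 2 * r + 5 + k := by
    unfold chainCut
    omega
  have e1 : chainCut r (k + 1) = 2 * r + 6 + k := by
    unfold chainCut
    omega
  refine exists_iso_chainBlock (Equiv.refl _) (by omega) (by omega) fun i j => ?_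
  have : (completeGraph (Fin 2)).Adj i j ↔ (i : ℕ) ≠ j := by
    rw [completeGraph_eq_top, top_adj, Ne, Fin.ext_iff]
  rw [this, e0]
  simp only [Equiv.refl_apply]
  rw [chainRel_two_iff hk i.2 j.2, chainRel_two_iff hk j.2 i.2]
  have := i.2
  have := j.2
  omega

/-- The vertices other than `v` are `v + 1, …, v + (k + 1)`, consecutive along the cycle. -/
theorem preconnected_induce_compl_of_cycleGraph_le {k : ℕ} {Q : SimpleGraph (Fin (k + 2))}
    (hQ : cycleGraph (k + 2) ≤ Q) (v : Fin (k + 2)) : (Q.induce {v}ᶜ).Preconnected := by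
  have hne : ∀ i : ℕ, i < k + 1 → v + (1 + Fin.ofNat (k + 2) i) ∈ ({v}ᶜ : Set (Fin (k + 2))) := by
    intro i hi h
    have h : v + (1 + Fin.ofNat (k + 2) i) = v := h
    rw [add_eq_left] at h
    have := congrArg Fin.val h
    simp [Fin.val_add, Nat.mod_eq_of_lt (show 1 + i < k + 2 by omega)] at this
  have key : ∀ i (hi : i < k + 1), (Q.induce {v}ᶜ).Reachable ⟨_, hne i hi⟩
      ⟨_, hne 0 (by omega)⟩ := by
    intro i
    induction i with
    | zero => intro _; rfl
    | succ i ih =>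
      intro hi
      refine Reachable.trans (Adj.reachable ?_) (ih (by omega))
      apply hQ
      rw [cycleGraph_adj]
      left
      have : Fin.ofNat (k + 2) (i + 1) = Fin.ofNat (k + 2) i + 1 := by
        apply Fin.ext
        simp [Fin.val_add]
      simp only [Function.Embedding.subtype_apply]
      rw [this]
      abel
  have hall : ∀ w : ({v}ᶜ : Set (Fin (k + 2))), ∃ i, ∃ hi : i < k + 1,
      w = ⟨_, hne i hi⟩ := by
    rintro ⟨w, hw⟩
    have h0 : (w - v - 1 : Fin (k + 2)).val < k + 1 := by
      by_contra hlt
      have h1 := (w - v - 1 : Fin (k + 2)).2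
      have h2 : w - v - 1 = Fin.last (k + 1) := Fin.ext (by simp; omega)
      apply hw
      have h3 : w - v = 0 := by
        rw [sub_eq_iff_eq_add] at h2
        rw [h2, Fin.last_add_one]
      exact sub_eq_zero.1 h3
    refine ⟨_, h0, Subtype.ext ?_⟩
    simp only [Fin.ofNat_eq_cast, Fin.cast_val_eq_self]
    abel
  intro x y
  obtain ⟨i, hi, rfl⟩ := hall x
  obtain ⟨j, hj, rfl⟩ := hall y
  exact (key i hi).trans (key j hj).symm

theorem Subgraph.isNonseparable_of_iso {V : Type*} {G : SimpleGraph V} {X : G.Subgraph} {k : ℕ}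
    {Q : SimpleGraph (Fin (k + 2))} (hQ : cycleGraph (k + 2) ≤ Q) (e : X.coe ≃g Q) :
    X.IsNonseparable := by
  constructor
  · rw [Subgraph.connected_iff', e.connected_iff]
    exact (cycleGraph_connected (n := k + 1)).mono hQ
  · intro v hv
    let φ : Q.induce {e ⟨v, hv⟩}ᶜ →g (X.deleteVerts {v}).coe :=
      { toFun := fun w => ⟨e.symm w, (e.symm w).2, fun h => w.2 (by
          have : e.symm w = ⟨v, hv⟩ := Subtype.ext h
          have := congrArg e this
          rwa [RelIso.apply_symm_apply] at this)⟩
        map_rel' := by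
          intro a b hab
          rw [Subgraph.coe_adj, Subgraph.deleteVerts_adj]
          refine ⟨(e.symm a).2, fun h => a.2 ?_, (e.symm b).2, fun h => b.2 ?_, ?_⟩
          · have : e.symm a = ⟨v, hv⟩ := Subtype.ext h
            have := congrArg e this
            rwa [RelIso.apply_symm_apply] at this
          · have : e.symm b = ⟨v, hv⟩ := Subtype.ext h
            have := congrArg e this
            rwa [RelIso.apply_symm_apply] at this
          · exact e.symm.map_rel_iff.2 hab }
    have hφ : Function.Surjective φ := by
      rintro ⟨w, hw1, hw2⟩
      refine ⟨⟨e ⟨w, hw1⟩, fun h => hw2 ?_⟩, ?_⟩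
      · exact congrArg Subtype.val (e.injective h)
      · apply Subtype.ext
        change ((e.symm (e ⟨w, hw1⟩) : X.verts) : V) = w
        rw [RelIso.symm_apply_apply]
    rw [Subgraph.preconnected_iff]
    intro x y
    obtain ⟨x, rfl⟩ := hφ x
    obtain ⟨y, rfl⟩ := hφ y
    exact (preconnected_induce_compl_of_cycleGraph_le hQ _ x y).map φ

theorem chainBlock_isNonseparable {r n k : ℕ} (hn : 3 * r + 7 ≤ n) (hk : 2 * r + 6 + k < n) :
    (chainBlock r n k).IsNonseparable := by
  rcases Nat.eq_zero_or_pos k with rfl | h1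
  · obtain ⟨e⟩ := exists_iso_chainBlock_zero hn
    exact Subgraph.isNonseparable_of_iso (k := 5) le_sup_left e
  by_cases hkr : k ≤ r
  · obtain ⟨e⟩ := exists_iso_chainBlock_four hn h1 hkr
    exact Subgraph.isNonseparable_of_iso (k := 2) le_rfl e
  · obtain ⟨e⟩ := exists_iso_chainBlock_two hk (by omega)
    -- `K₂` is treated as containing the degenerate cycle `cycleGraph 2`.
    exact Subgraph.isNonseparable_of_iso (k := 0) le_top e

/-- The graph is the union of the parts up to and from the cut vertex, so `le_or_le` applies. -/
theorem Subgraph.IsNonseparable.forall_le_or_forall_ge {r n : ℕ} {X : (chainGraph r n).Subgraph}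
    (hX : X.IsNonseparable) (k : ℕ) :
    (∀ v ∈ X.verts, (v : ℕ) ≤ chainCut r k) ∨ ∀ v ∈ X.verts, chainCut r k ≤ v := by
  by_cases hk : chainCut r k < n
  · let L : (chainGraph r n).Subgraph :=
      (⊤ : (chainGraph r n).Subgraph).induce {v | (v : ℕ) ≤ chainCut r k}
    let R : (chainGraph r n).Subgraph :=
      (⊤ : (chainGraph r n).Subgraph).induce {v | chainCut r k ≤ v}
    have hle : X ≤ L ⊔ R := by
      refine ⟨fun v _ => (le_total (v : ℕ) (chainCut r k)).elim Or.inl Or.inr, ?_⟩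
      intro a b hab
      have hab' := X.adj_sub hab
      have key : ∀ a b : Fin n, ChainRel r a b → (chainGraph r n).Adj a b →
          (L ⊔ R).Adj a b := by
        intro a b h h'
        have hlt := h.lt
        rcases h.le_chainCut_or_ge k with h1 | h1
        · exact Or.inl ⟨(by simp only [Set.mem_ofPred_eq]; omega), h1, h'⟩
        · exact Or.inr ⟨h1, (by simp only [Set.mem_ofPred_eq]; omega), h'⟩
      rcases id hab' with h | h
      · exact key a b h hab'
      · exact (key b a h hab'.symm).symm
    have hv : L.verts ∩ R.verts = {⟨chainCut r k, hk⟩} := by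
      ext v
      simp only [L, R, Subgraph.induce_verts, Set.mem_inter_iff, Set.mem_ofPred_eq,
        Set.mem_singleton_iff, Fin.ext_iff]
      omega
    rcases hX.le_or_le hle hv with h | h
    · exact Or.inl fun v hv => h.1 hv
    · exact Or.inr fun v hv => h.1 hv
  · exact Or.inl fun v _ => by have := v.2; omega

theorem le_chainCut_succ {r n k v : ℕ} (hn : 3 * r + 7 ≤ n) (hk : n ≤ 2 * r + 7 + k) (hv : v < n) :
    v ≤ chainCut r (k + 1) := by
  unfold chainCut
  omega

/-- The block is found at the last cut that has all of `X` on its right, among the indices up to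
that of the final block, `n - (2 * r + 7)`. -/
theorem Subgraph.IsNonseparable.exists_le_chainBlock {r n : ℕ} {X : (chainGraph r n).Subgraph}
    (hn : 3 * r + 7 ≤ n) (hX : X.IsNonseparable) :
    ∃ k, 2 * r + 6 + k < n ∧ X ≤ chainBlock r n k := by
  classical
  let P : ℕ → Prop := fun k => ∀ v ∈ X.verts, chainCut r k ≤ v
  obtain ⟨N, hNdef⟩ : ∃ N, N = n - (2 * r + 7) := ⟨_, rfl⟩
  have h0 : P 0 := fun v _ => by simp [chainCut]
  have hP : P (Nat.findGreatest P N) := Nat.findGreatest_spec (Nat.zero_le N) h0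
  have hN : Nat.findGreatest P N ≤ N := Nat.findGreatest_le N
  refine ⟨Nat.findGreatest P N, by omega, ?_⟩
  have hup : ∀ v ∈ X.verts, (v : ℕ) ≤ chainCut r (Nat.findGreatest P N + 1) := by
    by_cases hlt : Nat.findGreatest P N < N
    · refine (hX.forall_le_or_forall_ge _).resolve_right fun h => ?_
      exact Nat.findGreatest_is_greatest (Nat.lt_succ_self _) hlt h
    · exact fun v _ => le_chainCut_succ hn (by omega) v.2
  exact ⟨fun v hv => ⟨hP v hv, hup v hv⟩, fun a b hab => ⟨⟨hP a (X.edge_vert hab),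
    hup a (X.edge_vert hab)⟩, ⟨hP b (X.edge_vert hab.symm), hup b (X.edge_vert hab.symm)⟩,
    X.adj_sub hab⟩⟩

theorem eq_of_chainBlock_le {r n k k' : ℕ} (hk : chainCut r (k + 1) < n)
    (h : chainBlock r n k ≤ chainBlock r n k') : k = k' := by
  have hlt : chainCut r k < chainCut r (k + 1) := chainCut_strictMono r (Nat.lt_succ_self k)
  have h1 := h.1 (show (⟨chainCut r k, by omega⟩ : Fin n) ∈ (chainBlock r n k).verts from
    ⟨le_rfl, hlt.le⟩)
  have h2 := h.1 (show (⟨chainCut r (k + 1), hk⟩ : Fin n) ∈ (chainBlock r n k).verts from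
    ⟨hlt.le, le_rfl⟩)
  have h3 := (chainCut_strictMono r).le_iff_le.1 h1.1
  have h4 := (chainCut_strictMono r).le_iff_le.1 h2.2
  omega

theorem isBlock_chainGraph_iff {r n : ℕ} (hn : 3 * r + 7 ≤ n) {X : (chainGraph r n).Subgraph} :
    X.IsBlock ↔ ∃ k, 2 * r + 6 + k < n ∧ X = chainBlock r n k := by
  constructor
  · intro hX
    obtain ⟨k, hk, hle⟩ := hX.1.exists_le_chainBlock hn
    exact ⟨k, hk, le_antisymm hle (hX.2 (chainBlock_isNonseparable hn hk) hle)⟩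
  · rintro ⟨k, hk, rfl⟩
    refine ⟨chainBlock_isNonseparable hn hk, fun Y hY hle => ?_⟩
    obtain ⟨k', hk', hle'⟩ := Subgraph.IsNonseparable.exists_le_chainBlock hn hY
    have hcut : chainCut r (k + 1) < n := by
      unfold chainCut
      omega
    rwa [eq_of_chainBlock_le hcut (hle.trans hle')]

theorem ncard_isBlock_chainGraph {r n : ℕ} (hn : 3 * r + 7 ≤ n)
    {P : (chainGraph r n).Subgraph → Prop} {s : Set ℕ} (hs : ∀ k ∈ s, 2 * r + 6 + k < n)
    (hP : ∀ k, 2 * r + 6 + k < n → (P (chainBlock r n k) ↔ k ∈ s)) :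
    {X : (chainGraph r n).Subgraph | X.IsBlock ∧ P X}.ncard = s.ncard := by
  have : {X : (chainGraph r n).Subgraph | X.IsBlock ∧ P X} = chainBlock r n '' s := by
    ext X
    simp only [Set.mem_ofPred_eq, isBlock_chainGraph_iff hn, Set.mem_image]
    constructor
    · rintro ⟨⟨k, hk, rfl⟩, h⟩
      exact ⟨k, (hP k hk).1 h, rfl⟩
    · rintro ⟨k, hk, rfl⟩
      exact ⟨⟨k, hs k hk, rfl⟩, (hP k (hs k hk)).2 hk⟩
  rw [this, Set.InjOn.ncard_image]
  intro k hk k' hk' h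
  refine eq_of_chainBlock_le ?_ h.le
  have := hs k hk
  unfold chainCut
  omega

theorem Subgraph.ncard_verts_of_iso {V W : Type*} [Fintype W] {G : SimpleGraph V} {X : G.Subgraph}
    {Q : SimpleGraph W} (e : X.coe ≃g Q) : X.verts.ncard = Fintype.card W := by
  rw [← Nat.card_coe_set_eq, Nat.card_congr e.toEquiv, Nat.card_eq_fintype_card]

/-- Vertex `0` has the three neighbors `1`, `2` and `6`. -/
theorem not_isCycleGraph_of_iso {V : Type*} {G : SimpleGraph V} {X : G.Subgraph}
    (e : X.coe ≃g (cycleGraph 7 ⊔ edge 0 2)) : ¬ X.IsCycleGraph := by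
  rintro ⟨m, hm, ⟨e'⟩⟩
  have h1 := Subgraph.ncard_verts_of_iso e
  have h2 := Subgraph.ncard_verts_of_iso e'
  simp only [Fintype.card_fin] at h1 h2
  obtain rfl : m = 7 := by omega
  have f : cycleGraph 7 ≃g (cycleGraph 7 ⊔ edge 0 2) := e'.symm.trans e
  have hdeg : ∀ v : Fin 7, (cycleGraph 7).degree v = 2 := fun v => cycleGraph_degree_three_le
  have h3 : ({f.symm 1, f.symm 2, f.symm 6} : Finset (Fin 7)) ⊆
      (cycleGraph 7).neighborFinset (f.symm 0) := by
    intro w hw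
    rw [mem_neighborFinset]
    simp only [Finset.mem_insert, Finset.mem_singleton] at hw
    rcases hw with rfl | rfl | rfl <;> rw [f.symm.map_adj_iff, cycleGraph_seven_chord_adj] <;>
      decide
  have h4 := Finset.card_le_card h3
  rw [card_neighborFinset_eq_degree, hdeg, Finset.card_eq_three.2 ⟨_, _, _, ?_, ?_, ?_, rfl⟩] at h4
  · omega
  all_goals
    rw [f.symm.injective.ne_iff]
    decide

/-- Leaving a set of vertices along an edge of a connected subgraph. -/
theorem Subgraph.Connected.exists_adj_boundary {V : Type*} {G : SimpleGraph V} {T : G.Subgraph}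
    (hT : T.Connected) (U : Set V) {x y : V} (hx : x ∈ T.verts) (hy : y ∈ T.verts) (hxU : x ∈ U)
    (hyU : y ∉ U) : ∃ p ∈ U, ∃ q, q ∉ U ∧ T.Adj p q := by
  obtain ⟨w⟩ := hT.preconnected ⟨x, hx⟩ ⟨y, hy⟩
  obtain ⟨⟨⟨p, q⟩, h⟩, -, hp, hq⟩ := w.exists_boundary_dart {v | (v : V) ∈ U} hxU hyU
  exact ⟨p, hp, q, hq, h⟩

/-- The distance from the block `0` along the chain. -/
def chainLevel (r v : ℕ) : ℕ :=
  if v ≤ 6 then 0 else if v ≤ 3 * r + 6 then 2 * ((v - 6) / 3) + min ((v - 6) % 3) 1 else v - 6 - r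

theorem ChainRel.chainLevel_le {r i j : ℕ} (h : ChainRel r i j) :
    chainLevel r i ≤ chainLevel r j ∧ chainLevel r j ≤ chainLevel r i + 1 := by
  unfold ChainRel at h
  unfold chainLevel
  split_ifs
  all_goals
    rcases h with h | ⟨h1, h2, h | h | h⟩ | h
    all_goals omega

theorem chainLevel_last {r n : ℕ} (hn : 3 * r + 7 ≤ n) : chainLevel r (n - 1) = n - 7 - r := by
  unfold chainLevel
  split_ifs <;> omega

/-- A connected subgraph of the chain graph through two suitable vertices of the first block and
the end of the chain has many vertices. -/
theorem le_ncard_verts_of_connected {r n : ℕ} (hn : 3 * r + 7 ≤ n)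
    {T : (chainGraph r n).Subgraph} (hT : T.Connected) (h1 : (⟨1, by omega⟩ : Fin n) ∈ T.verts)
    (h4 : (⟨4, by omega⟩ : Fin n) ∈ T.verts) (hl : (⟨n - 1, by omega⟩ : Fin n) ∈ T.verts) :
    n - r - 2 ≤ T.verts.ncard := by
  have hfar : n - 7 - r ≤ {v | v ∈ T.verts ∧ 6 < (v : ℕ)}.ncard := by
    -- Levels change by at most one along an edge, so `T` meets every level on the way to the end.
    -- The two middle vertices of a 4-cycle share a level; thus one vertex per 4-cycle can be
    -- missed.
    have hsub : Set.Icc 1 (n - 7 - r) ⊆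
        (fun v : Fin n => chainLevel r v) '' {v | v ∈ T.verts ∧ 6 < (v : ℕ)} := by
      rintro t ⟨ht1, ht2⟩
      obtain ⟨p, hp, q, hq, hpq⟩ := hT.exists_adj_boundary {v | t ≤ chainLevel r v} hl h4
        (by simp only [Set.mem_ofPred_eq, chainLevel_last hn]; exact ht2)
        (by simp [chainLevel]; omega)
      simp only [Set.mem_ofPred_eq] at hp hq
      refine ⟨p, ⟨T.edge_vert hpq, ?_⟩, ?_⟩
      · by_contra hp6
        have : chainLevel r p = 0 := if_pos (by omega)
        omega
      · rcases T.adj_sub hpq with h | h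
        · have := h.chainLevel_le
          simp only
          omega
        · have := h.chainLevel_le
          simp only
          omega
    have := (Set.ncard_le_ncard hsub (Set.toFinite _)).trans (Set.ncard_image_le (Set.toFinite _))
    rw [← Finset.coe_Icc, Set.ncard_coe_finset, Nat.card_Icc] at this
    omega
  -- The five vertices are `1` and `4`, a neighbor of each (`0` or `2`, respectively `3` or `5`),
  -- and the exit `6`; the neighborhoods of `1` and `4` are disjoint and do not contain `6`.
  have hnear : 5 ≤ {v | v ∈ T.verts ∧ (v : ℕ) ≤ 6}.ncard := by
    obtain ⟨a, ha, b, hb, hab⟩ := hT.exists_adj_boundary {v | (v : ℕ) = 1} h1 h4 rfl (by simp)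
    obtain ⟨c, hc, d, hd, hcd⟩ := hT.exists_adj_boundary {v | (v : ℕ) = 4} h4 h1 rfl (by simp)
    obtain ⟨p, hp, q, hq, hpq⟩ := hT.exists_adj_boundary {v | 6 ≤ (v : ℕ)} hl h4
      (by simp only [Set.mem_ofPred_eq]; omega) (by simp)
    simp only [Set.mem_ofPred_eq] at ha hb hc hd hp hq
    have hb' : (b : ℕ) = 0 ∨ (b : ℕ) = 2 := by
      rcases T.adj_sub hab with h | h <;> unfold ChainRel at h <;> omega
    have hd' : (d : ℕ) = 3 ∨ (d : ℕ) = 5 := by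
      rcases T.adj_sub hcd with h | h <;> unfold ChainRel at h <;> omega
    have hp' : (p : ℕ) = 6 := by
      rcases T.adj_sub hpq with h | h <;> unfold ChainRel at h <;> omega
    have hsub : (({a, b, c, d, p} : Finset (Fin n)) : Set (Fin n)) ⊆
        {v | v ∈ T.verts ∧ (v : ℕ) ≤ 6} := by
      intro v hv
      simp only [Finset.coe_insert, Finset.coe_singleton, Set.mem_insert_iff,
        Set.mem_singleton_iff] at hv
      rcases hv with rfl | rfl | rfl | rfl | rfl
      · exact ⟨T.edge_vert hab, by omega⟩
      · exact ⟨T.edge_vert hab.symm, by omega⟩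
      · exact ⟨T.edge_vert hcd, by omega⟩
      · exact ⟨T.edge_vert hcd.symm, by omega⟩
      · exact ⟨T.edge_vert hpq, by omega⟩
    have := Set.ncard_le_ncard hsub (Set.toFinite _)
    rw [Set.ncard_coe_finset] at this
    refine le_trans (le_of_eq ?_) this
    symm
    rw [Finset.card_insert_of_notMem, Finset.card_insert_of_notMem, Finset.card_insert_of_notMem,
      Finset.card_pair]
    all_goals
      simp only [Finset.mem_insert, Finset.mem_singleton, ne_eq, Fin.ext_iff]
      omega
  have hunion : T.verts = {v | v ∈ T.verts ∧ (v : ℕ) ≤ 6} ∪ {v | v ∈ T.verts ∧ 6 < (v : ℕ)} := by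
    ext v
    simp only [Set.mem_union, Set.mem_ofPred_eq]
    have := le_or_gt (v : ℕ) 6
    tauto
  rw [hunion, Set.ncard_union_eq (by
    rw [Set.disjoint_left]
    rintro v ⟨-, h⟩ ⟨-, h'⟩
    omega)]
  omega

/-- A rainbow tree has at most one more vertex than there are colors. -/
theorem IsRainbowTree.ncard_verts_le {V : Type*} [Finite V] {G : SimpleGraph V} {m : ℕ}
    {c : G.EdgeLabeling (Fin m)} {T : G.Subgraph} (hT : IsRainbowTree c T) :
    T.verts.ncard ≤ m + 1 := by
  classical
  have : Fintype V := Fintype.ofFinite V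
  have h1 := hT.1.card_edgeFinset
  have hmem : ∀ e : T.coe.edgeSet, (e : Sym2 T.verts).map Subtype.val ∈ T.edgeSet := by
    rintro ⟨e, he⟩
    induction e with | _ a b =>
    exact he
  let f : T.coe.edgeSet → Fin m := fun e =>
    c ⟨(e : Sym2 T.verts).map Subtype.val, T.edgeSet_subset (hmem e)⟩
  have hf : Function.Injective f := by
    intro e e' h
    have := hT.2 (hmem e) (hmem e') h
    exact Subtype.ext (Sym2.map.injective Subtype.val_injective (congrArg Subtype.val this))
  have h2 := Fintype.card_le_of_injective f hf
  rw [Fintype.card_fin, ← edgeFinset_card] at h2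
  rw [← Nat.card_coe_set_eq, Nat.card_eq_fintype_card]
  omega

/-- The triple `1`, `4`, `n - 1` forces a rainbow tree with at least `n - r - 2` vertices, hence at
least `n - r - 3` colors. -/
theorem le_rainbowIndex_chainGraph {r n : ℕ} (hn : 3 * r + 7 ≤ n) :
    ((n - r - 3 : ℕ) : ℕ∞) ≤ (chainGraph r n).rainbowIndex 3 := by
  refine le_iInf₂ fun m hm => ?_
  obtain ⟨c, hc⟩ := hm
  obtain ⟨T, hT, hS⟩ := hc {⟨1, by omega⟩, ⟨4, by omega⟩, ⟨n - 1, by omega⟩} (by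
    rw [Finset.card_eq_three]
    refine ⟨⟨1, by omega⟩, ⟨4, by omega⟩, ⟨n - 1, by omega⟩, ?_, ?_, ?_, rfl⟩ <;>
      simp only [ne_eq, Fin.mk.injEq] <;> omega)
  have h1 := le_ncard_verts_of_connected hn (Subgraph.connected_iff'.2 hT.1.connected)
    (hS (by simp)) (hS (by simp)) (hS (by simp))
  have h2 := hT.ncard_verts_le
  exact_mod_cast (by omega : n - r - 3 ≤ m)

end Extremal

end SimpleGraph

theorem mainTheorem3 :
    -- the upper bound `rx_3(G) ≤ n - |C| - 2|D| - 1`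
    (∀ (V : Type*) [Fintype V] (G : SimpleGraph V), G.Connected → 3 ≤ Fintype.card V →
      G.rainbowIndex 3 + (G.blocksC.ncard + 2 * G.blocksD.ncard + 1 : ℕ)
        ≤ (Fintype.card V : ℕ∞)) ∧
    -- tightness: graphs of order `n` whose blocks are `n - 3r - 7` copies of `K_2`, `r` cycles of
    -- order `4` and one cycle of order `7` with a chord
    (∀ r n : ℕ, 3 * r + 7 ≤ n → ∃ G : SimpleGraph (Fin n), G.Connected ∧
      {X : G.Subgraph | X.IsBlock ∧
        Nonempty (X.coe ≃g SimpleGraph.completeGraph (Fin 2))}.ncard = n - 3 * r - 7 ∧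
      {X : G.Subgraph | X.IsBlock ∧ Nonempty (X.coe ≃g SimpleGraph.cycleGraph 4)}.ncard = r ∧
      {X : G.Subgraph | X.IsBlock ∧ X.IsCycleWithChord 7}.ncard = 1 ∧
      (∀ X : G.Subgraph, X.IsBlock →
        Nonempty (X.coe ≃g SimpleGraph.completeGraph (Fin 2)) ∨
        Nonempty (X.coe ≃g SimpleGraph.cycleGraph 4) ∨ X.IsCycleWithChord 7) ∧
      G.blocksC.ncard = r ∧ G.blocksD.ncard = 1 ∧
      G.rainbowIndex 3 + (G.blocksC.ncard + 2 * G.blocksD.ncard + 1 : ℕ) = (n : ℕ∞) ∧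
      G.rainbowIndex 3 = (n - r - 3 : ℕ)) := by
  refine ⟨fun V _ G hG _ => hG.rainbowIndex_three_add_le, fun r n hn => ?_⟩
  have hconn : (SimpleGraph.chainGraph r n).Connected := SimpleGraph.chainGraph_connected (by omega)
  have hB0 := SimpleGraph.exists_iso_chainBlock_zero hn
  have hB4 := fun k h1 hk => SimpleGraph.exists_iso_chainBlock_four (k := k) hn h1 hk
  have hB2 := fun k hk h => SimpleGraph.exists_iso_chainBlock_two (r := r) (n := n) (k := k) hk h
  have c0 : (SimpleGraph.chainBlock r n 0).verts.ncard = 7 := by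
    obtain ⟨e⟩ := hB0
    simpa using SimpleGraph.Subgraph.ncard_verts_of_iso e
  have c4 : ∀ k, 1 ≤ k → k ≤ r → (SimpleGraph.chainBlock r n k).verts.ncard = 4 := fun k h1 hk => by
    obtain ⟨e⟩ := hB4 k h1 hk
    simpa using SimpleGraph.Subgraph.ncard_verts_of_iso e
  have c2 : ∀ k, 2 * r + 6 + k < n → r < k → (SimpleGraph.chainBlock r n k).verts.ncard = 2 :=
    fun k hk h => by
      obtain ⟨e⟩ := hB2 k hk h
      simpa using SimpleGraph.Subgraph.ncard_verts_of_iso e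
  have hcase : ∀ k, 2 * r + 6 + k < n →
      (k = 0 ∧ (SimpleGraph.chainBlock r n k).verts.ncard = 7) ∨
      ((1 ≤ k ∧ k ≤ r) ∧ (SimpleGraph.chainBlock r n k).verts.ncard = 4) ∨
      (r < k ∧ (SimpleGraph.chainBlock r n k).verts.ncard = 2) := by
    intro k hk
    rcases Nat.eq_zero_or_pos k with rfl | h1
    · exact Or.inl ⟨rfl, c0⟩
    by_cases hkr : k ≤ r
    · exact Or.inr (Or.inl ⟨⟨h1, hkr⟩, c4 k h1 hkr⟩)
    · exact Or.inr (Or.inr ⟨by omega, c2 k hk (by omega)⟩)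
  have hcyc0 : ¬ (SimpleGraph.chainBlock r n 0).IsCycleGraph := by
    obtain ⟨e⟩ := hB0
    exact SimpleGraph.not_isCycleGraph_of_iso e
  have hchord0 : (SimpleGraph.chainBlock r n 0).IsCycleWithChord 7 :=
    ⟨0, 2, by decide, by rw [SimpleGraph.cycleGraph_adj']; decide, hB0⟩
  have hncC : (SimpleGraph.chainGraph r n).blocksC.ncard = r := by
    refine (SimpleGraph.ncard_isBlock_chainGraph hn (s := Set.Icc 1 r)
      (fun k hk => by have := hk.2; omega) fun k hk => ?_).trans ?_
    · rcases hcase k hk with ⟨rfl, h⟩ | ⟨h1, h⟩ | ⟨h1, h⟩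
      · simp [h, hcyc0]
      · simp [h, h1]
      · simp [h]
        omega
    · rw [← Finset.coe_Icc, Set.ncard_coe_finset, Nat.card_Icc]
      omega
  have hncD : (SimpleGraph.chainGraph r n).blocksD.ncard = 1 := by
    refine (SimpleGraph.ncard_isBlock_chainGraph hn (s := {0})
      (fun k hk => by have : k = 0 := hk; omega) fun k hk => ?_).trans (Set.ncard_singleton 0)
    rcases hcase k hk with ⟨rfl, h⟩ | ⟨h1, h⟩ | ⟨h1, h⟩
    · simp [h, hcyc0]
    · simp [h]
      omega
    · simp [h]
      omega
  have hub := hconn.rainbowIndex_three_add_le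
  rw [hncC, hncD, Fintype.card_fin] at hub
  have hidx : (SimpleGraph.chainGraph r n).rainbowIndex 3 = (n - r - 3 : ℕ) := by
    refine le_antisymm ?_ (SimpleGraph.le_rainbowIndex_chainGraph hn)
    -- Written as a sum, `n` allows the finite term `r + 3` to be cancelled from the upper bound in
    -- `ℕ∞`.
    have hn' : (n : ℕ∞) = (n - r - 3 : ℕ) + (r + 2 * 1 + 1 : ℕ) := by
      rw [← Nat.cast_add]
      congr 1
      omega
    rw [hn'] at hub
    exact (ENat.add_le_add_iff_right (ENat.natCast_ne_top _)).1 hub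
  refine ⟨SimpleGraph.chainGraph r n, hconn, ?_, ?_, ?_, ?_, hncC, hncD, ?_, hidx⟩
  · refine (SimpleGraph.ncard_isBlock_chainGraph hn (s := Set.Ico (r + 1) (n - 2 * r - 6))
      (fun k hk => by have := hk.2; omega) fun k hk => ?_).trans ?_
    · constructor
      · rintro ⟨e⟩
        have := SimpleGraph.Subgraph.ncard_verts_of_iso e
        rw [Fintype.card_fin] at this
        have := hcase k hk
        exact ⟨by omega, by omega⟩
      · intro h
        exact hB2 k hk h.1
    · rw [← Finset.coe_Ico, Set.ncard_coe_finset, Nat.card_Ico]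
      omega
  · refine (SimpleGraph.ncard_isBlock_chainGraph hn (s := Set.Icc 1 r)
      (fun k hk => by have := hk.2; omega) fun k hk => ?_).trans ?_
    · constructor
      · rintro ⟨e⟩
        have := SimpleGraph.Subgraph.ncard_verts_of_iso e
        rw [Fintype.card_fin] at this
        have := hcase k hk
        exact ⟨by omega, by omega⟩
      · intro h
        exact hB4 k h.1 h.2
    · rw [← Finset.coe_Icc, Set.ncard_coe_finset, Nat.card_Icc]
      omega
  · refine (SimpleGraph.ncard_isBlock_chainGraph hn (s := {0})
      (fun k hk => by have : k = 0 := hk; omega) fun k hk => ?_).trans (Set.ncard_singleton 0)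
    constructor
    · rintro ⟨a, b, -, -, ⟨e⟩⟩
      have := SimpleGraph.Subgraph.ncard_verts_of_iso e
      rw [Fintype.card_fin] at this
      have := hcase k hk
      exact (by omega : k = 0)
    · rintro rfl
      exact hchord0
  · intro X hX
    obtain ⟨k, hk, rfl⟩ := (SimpleGraph.isBlock_chainGraph_iff hn).1 hX
    rcases hcase k hk with ⟨rfl, -⟩ | ⟨h1, -⟩ | ⟨h1, -⟩
    · exact Or.inr (Or.inr hchord0)
    · exact Or.inr (Or.inl (hB4 k h1.1 h1.2))
    · exact Or.inl (hB2 k hk h1)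
  · rw [hncC, hncD, hidx, ← Nat.cast_add]
    congr 1
    omega
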